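/- Fix $n\ge 0$. A planar network $\Gamma$ of order $n$ is a finite directed acyclic graph (parallel edges allowed) with exactly $n$ sources (vertices without incoming edges) $s_1,\dots,s_n$ and exactly $n$ sinks (vertices without outgoing edges) $t_1,\dots,t_n$, drawn in the plane without crossings so that every edge is an $x$-monotone curve directed from left to right (the graph of a continuous function over an interval of positive length), the sources lie on a vertical line on the left in the order $s_1,\dots,s_n$ from top to bottom, and the sinks lie on a vertical line on the right in the order $t_1,\dots,t_n$ from top to bottom; so in counterclockwise order the boundary vertices are $s_1,\dots,s_n,t_n,\dots,t_1$. Attach to each edge $e$ of $\Gamma$ its own indeterminate $x_e$, its weight. The weight $\omega(\pi)$ of a directed path $\pi$ is the product of the weights of its edges, and the weight matrix of $\Gamma$ is the $n\times n$ matrix $W=(w_{i,j})$ over $\mathbb{Z}[x_e : e \text{ an edge of }\Gamma]$ with $$w_{i,j}=\sum_{\pi}\omega(\pi),$$ the sum being over all directed paths $\pi$ from $s_i$ to $t_j$. For sets of indices $I,J$ of equal cardinality, $W[I,J]$ denotes the submatrix with rows in $I$ and columns in $J$, each in increasing order, and $\det W[I,J]$ is called the $(I,J)$-minor of $W$; minors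 of other matrices are defined in the same way. Let $A,B\subseteq\{0,1,\dots,n-1\}$ be sets of equal cardinality. The $(A,B)$-minor matrix of $W$ is the matrix $T=(t_{i,j})$ with $$t_{i,j}=\det W[i+A,\,j+B],$$ where $i$ and $j$ range over the elements of $\{1,\dots,n\}$ with $i+A\subseteq\{1,\dots,n\}$ and $j+B\subseteq\{1,\dots,n\}$. **Theorem.** For every planar network $\Gamma$ of order $n$ and all such $A,B$, every $2\times 2$ minor of $T$ is a polynomial in the edge weights $x_e$ having no negative coefficients. -/

import Mathlib

/-- A planar network of order `n` with vertex set `V` and edge set `E`, together with its drawing: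
a finite directed graph (parallel edges are allowed) drawn in the plane without crossings, with
every edge an `x`-monotone curve running from left to right (so the graph is acyclic), whose
sources are exactly the `n` vertices `source 0, …, source (n - 1)`, lying from top to bottom on
the left boundary line, and whose sinks are exactly the `n` vertices `sink 0, …, sink (n - 1)`,
lying from top to bottom on the right boundary line.  Thus the counterclockwise order on the
boundary is `s₁, …, sₙ, tₙ, …, t₁`, with `sᵢ = source (i - 1)` and `tᵢ = sink (i - 1)`. -/
structure PlanarNetwork (n : ℕ) (V E : Type*) [Finite V] [Finite E] where
  /-- initial vertex of an edge -/
  src : E → V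
  /-- terminal vertex of an edge -/
  tgt : E → V
  /-- the point of the plane at which a vertex is drawn -/
  pos : V → ℝ × ℝ
  pos_injective : Function.Injective pos
  /-- the edge `e` is drawn as the graph of `height e` over the interval between the abscissas
  of its initial and terminal vertices -/
  height : E → ℝ → ℝ
  left_to_right : ∀ e, (pos (src e)).1 < (pos (tgt e)).1
  height_continuousOn : ∀ e,
    ContinuousOn (height e) (Set.Icc (pos (src e)).1 (pos (tgt e)).1)
  height_src : ∀ e, height e (pos (src e)).1 = (pos (src e)).2
  height_tgt : ∀ e, height e (pos (tgt e)).1 = (pos (tgt e)).2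
  /-- no edge passes through a vertex, except at its two ends -/
  height_ne_vertex : ∀ e v, (pos v).1 ∈ Set.Ioo (pos (src e)).1 (pos (tgt e)).1 →
    height e (pos v).1 ≠ (pos v).2
  /-- different edges have disjoint interiors -/
  height_ne_height : ∀ e e', e ≠ e' → ∀ x,
    x ∈ Set.Ioo (pos (src e)).1 (pos (tgt e)).1 →
    x ∈ Set.Ioo (pos (src e')).1 (pos (tgt e')).1 → height e x ≠ height e' x
  /-- abscissa of the left boundary line -/
  left : ℝ
  /-- abscissa of the right boundary line -/
  right : ℝ
  left_lt_right : left < right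
  source : Fin n → V
  sink : Fin n → V
  /-- the listed sources are exactly the vertices without incoming edges -/
  mem_range_source : ∀ v, v ∈ Set.range source ↔ ∀ e, tgt e ≠ v
  /-- the listed sinks are exactly the vertices without outgoing edges -/
  mem_range_sink : ∀ v, v ∈ Set.range sink ↔ ∀ e, src e ≠ v
  source_left : ∀ i, (pos (source i)).1 = left
  sink_right : ∀ i, (pos (sink i)).1 = right
  source_order : ∀ i j, i < j → (pos (source j)).2 < (pos (source i)).2
  sink_order : ∀ i j, i < j → (pos (sink j)).2 < (pos (sink i)).2

namespace PlanarNetwork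

variable {n : ℕ} {V E : Type*} [Finite V] [Finite E]

/-- The list of edges `p` is a directed path from `u` to `v`. -/
def IsPath (Γ : PlanarNetwork n V E) : V → V → List E → Prop
  | u, v, [] => u = v
  | u, v, e :: p => Γ.src e = u ∧ Γ.IsPath (Γ.tgt e) v p

/-- Abscissas of edges of a path lie to the right of its starting point. -/
theorem IsPath.le_src (Γ : PlanarNetwork n V E) (p : List E) :
    ∀ u v, Γ.IsPath u v p → ∀ e ∈ p, (Γ.pos u).1 ≤ (Γ.pos (Γ.src e)).1 := by
  induction p with
  | nil => intro u v _ e he; simp at he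
  | cons d p ih =>
    rintro u v ⟨rfl, h⟩ e he
    rcases List.mem_cons.1 he with rfl | he
    · exact le_rfl
    · exact (Γ.left_to_right d).le.trans (ih _ _ h e he)

theorem IsPath.nodup (Γ : PlanarNetwork n V E) (p : List E) :
    ∀ u v, Γ.IsPath u v p → p.Nodup := by
  induction p with
  | nil => intro u v _; exact List.nodup_nil
  | cons d p ih =>
    rintro u v ⟨rfl, h⟩
    refine List.nodup_cons.2 ⟨fun hd => ?_, ih _ _ h⟩
    exact absurd (IsPath.le_src Γ p _ _ h d hd) (not_le.2 (Γ.left_to_right d))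

theorem finite_setOf_isPath (Γ : PlanarNetwork n V E) (u v : V) :
    {p : List E | Γ.IsPath u v p}.Finite := by
  have := Fintype.ofFinite E
  refine (List.finite_length_le E (Fintype.card E)).subset fun p hp => ?_
  exact (IsPath.nodup Γ p u v hp).length_le_card

/-- The finite set of all directed paths from `u` to `v`. -/
noncomputable def paths (Γ : PlanarNetwork n V E) (u v : V) : Finset (List E) :=
  (Γ.finite_setOf_isPath u v).toFinset

/-- The weight of a path: the product of the weights of its edges, where the weight of the edge
`e` is the indeterminate `X e`. -/
noncomputable def pathWeight (p : List E) : MvPolynomial E ℤ :=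
  (p.map MvPolynomial.X).prod

/-- The weight matrix: its entry at `(i, j)` is the sum of the weights of all paths from the
`i`-th source to the `j`-th sink. -/
noncomputable def weightMatrix (Γ : PlanarNetwork n V E) :
    Matrix (Fin n) (Fin n) (MvPolynomial E ℤ) :=
  Matrix.of fun i j => ∑ p ∈ Γ.paths (Γ.source i) (Γ.sink j), pathWeight p

end PlanarNetwork

/-- The `(I, J)`-minor `det W[I, J]`, rows and columns being listed in increasing order. -/
noncomputable def Matrix.setMinor {α β R : Type*} [LinearOrder α] [LinearOrder β] [CommRing R]
    (W : Matrix α β R) {k : ℕ} (I : Finset α) (J : Finset β) (hI : I.card = k)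
    (hJ : J.card = k) : R :=
  (W.submatrix (I.orderEmbOfFin hI) (J.orderEmbOfFin hJ)).det

/-- The indices `i` of rows (or columns) for which `i + A` consists of indices. -/
abbrev ShiftIndex (m : ℕ) (A : Finset ℕ) : Type :=
  {i : Fin m // ∀ a ∈ A, (i : ℕ) + a < m}

/-- The set `i + A`. -/
def ShiftIndex.shift {m : ℕ} {A : Finset ℕ} (i : ShiftIndex m A) : Finset (Fin m) :=
  A.attach.map ⟨fun a => ⟨(i.1 : ℕ) + a.1, i.2 a.1 a.2⟩, fun _ _ h =>
    Subtype.ext (Nat.add_left_cancel (Fin.mk.inj h))⟩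

theorem ShiftIndex.mem_shift {m : ℕ} {A : Finset ℕ} (i : ShiftIndex m A) (x : Fin m) :
    x ∈ i.shift ↔ ∃ a ∈ A, (i.1 : ℕ) + a = x := by
  constructor
  · intro h
    obtain ⟨a, -, rfl⟩ := Finset.mem_map.1 h
    exact ⟨a.1, a.2, rfl⟩
  · rintro ⟨a, ha, h⟩
    exact Finset.mem_map.2 ⟨⟨a, ha⟩, Finset.mem_attach _ _, Fin.ext h⟩

theorem ShiftIndex.card_shift {m : ℕ} {A : Finset ℕ} (i : ShiftIndex m A) :
    i.shift.card = A.card := by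
  simp [ShiftIndex.shift]

/-- The `(A, B)`-minor matrix of `W`, with entries `det W[i + A, j + B]`. -/
noncomputable def Matrix.minorMatrix {R : Type*} [CommRing R] {m n k : ℕ}
    (W : Matrix (Fin m) (Fin n) R) (A B : Finset ℕ) (hA : A.card = k) (hB : B.card = k) :
    Matrix (ShiftIndex m A) (ShiftIndex n B) R :=
  Matrix.of fun i j =>
    W.setMinor i.shift j.shift (i.card_shift.trans hA) (j.card_shift.trans hB)

/-! Let `I, I'` be `i+A, i'+A` with `i < i'`, and `J, J'` be `j+B, j'+B` with `j < j'`. The minor is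
`W[I,J] W[I',J'] - W[I,J'] W[I',J]`. By Lindström's lemma each factor sums the weights of families
of vertex-disjoint paths, so it suffices to inject pairs of families (`I` to `J'`, `I'` to `J`) into
pairs (`I` to `J`, `I'` to `J'`), preserving weights. The difference is then a sum of monomials over
the pairs not reached.

Superpose the two families and discard common edges. Give each region of the plane the height: paths
of the first family above it minus paths of the second. A remaining edge separates two consecutive
heights; the lower one is its `level`. Where the families touch, let the curve turn back: the two
incoming edges are joined, and so are the two outgoing ones. The level is then constant on
components. Since `I'` lies below `I`, levels are nonnegative on the left; since the first family
ends in the lower set `J'`, they are negative on the right. So no component joins left to right, and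
exchanging the families on the components that reach the right swaps `J` and `J'` but fixes `I` and
`I'`. The components do not depend on which family owns an edge, so the exchange is an involution,
hence injective.

The drawing is cut by vertical lines into layers of linearly ordered strands, and `W` becomes a
product of matrices whose minors are zero or monomials. Main lemmas: `minorOrZero_layerProd`
(Lindström), `IsLinked.isClosedAt_level_neg` (constant level), `IsFamily.exchangeRight`,
`minorOrZero_layerProd_mul_sub_mem` (injection), `layerProd_joinMatrix_apply` (factorization of
`W`). -/

/-! ### Cauchy–Binet and minors with arbitrary index sets. -/

namespace Matrix

/-- The determinant of a product of two rectangular matrices, expanded in the rows of the second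
factor. -/
theorem det_mul_eq_sum_det_submatrix {r : ℕ} {m R : Type*} [CommRing R] [Fintype m]
    (A : Matrix (Fin r) m R) (B : Matrix m (Fin r) R) :
    (A * B).det = ∑ p : Fin r → m, (∏ i, A i (p i)) * (B.submatrix p id).det := by
  classical
  have h : (A * B) = fun i => ∑ j, A i j • B j := by
    ext i j
    simp [Matrix.mul_apply, Finset.sum_apply]
  have h2 := (detRowAlternating (n := Fin r) (R := R)).toMultilinearMap.map_sum
    (fun i j => A i j • B j)
  have h3 : ∀ p : Fin r → m, (detRowAlternating (n := Fin r) (R := R)).toMultilinearMap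
      (fun i => A i (p i) • B (p i)) = (∏ i, A i (p i)) * (B.submatrix p id).det := fun p => by
    rw [MultilinearMap.map_smul_univ]
    rfl
  simp only [h3] at h2
  rw [← h2, h]
  rfl

/-- The **Cauchy–Binet formula**. -/
theorem det_mul_eq_sum_finset {r : ℕ} {m R : Type*} [CommRing R] [Fintype m] [LinearOrder m]
    (A : Matrix (Fin r) m R) (B : Matrix m (Fin r) R) :
    (A * B).det = ∑ K : Finset m, if h : K.card = r then
      (A.submatrix id (K.orderEmbOfFin h)).det * (B.submatrix (K.orderEmbOfFin h) id).det
      else 0 := by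
  classical
  rw [det_mul_eq_sum_det_submatrix,
    ← Finset.sum_fiberwise_of_maps_to (s := Finset.univ) (t := Finset.univ)
      (g := fun p : Fin r → m => Finset.univ.image p) (fun _ _ => Finset.mem_univ _)]
  refine Finset.sum_congr rfl fun K _ => ?_
  have hzero : ∀ p : Fin r → m, ¬ Function.Injective p → (B.submatrix p id).det = 0 := by
    intro p hp
    obtain ⟨i, j, hij, hne⟩ : ∃ i j, p i = p j ∧ i ≠ j := by
      simpa [Function.Injective] using hp
    refine det_zero_of_row_eq hne ?_
    ext k
    simp [hij]
  split_ifs with h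
  -- The product of minors is expanded by the same row formula; its index `q` corresponds to `p = K
  -- ∘ q`, and non-injective `q` contribute zero.
  · rw [← det_mul, det_mul_eq_sum_det_submatrix]
    symm
    refine Finset.sum_of_injOn (fun q i => K.orderEmbOfFin h (q i)) ?_ ?_ ?_ ?_ |>.trans
      (Finset.sum_filter _ _).symm
    · intro q _ q' _ hqq
      funext i
      exact (K.orderEmbOfFin h).injective (congrFun hqq i)
    · intro q _
      simp
    · intro p _ hp
      rw [ite_eq_right_iff]
      intro hpK
      refine absurd ?_ hp
      have : ∀ i, ∃ j, K.orderEmbOfFin h j = p i := fun i => by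
        have : p i ∈ Set.range (K.orderEmbOfFin h) := by
          rw [Finset.range_orderEmbOfFin, ← hpK]
          simp
        exact this
      choose q hq using this
      exact ⟨q, by simp, funext hq⟩
    · intro q _
      by_cases hq : Function.Injective q
      · rw [if_pos]
        · rfl
        · refine Finset.eq_of_subset_of_card_le ?_ ?_
          · intro x hx
            obtain ⟨i, -, rfl⟩ := Finset.mem_image.1 hx
            exact Finset.orderEmbOfFin_mem _ _ _
          · rw [Finset.card_image_of_injective (f := fun i => K.orderEmbOfFin h (q i)) _
              ((K.orderEmbOfFin h).injective.comp hq)]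
            simp [h]
      · have hq' : ¬ Function.Injective fun i => K.orderEmbOfFin h (q i) := fun hi =>
          hq fun a b hab => hi (congrArg (K.orderEmbOfFin h) hab)
        rw [hzero _ hq']
        rw [submatrix_submatrix]
        rw [show (B.submatrix (K.orderEmbOfFin h ∘ q) (id ∘ id)).det = 0 from hzero _ hq']
        simp
  · refine Finset.sum_eq_zero fun p hp => ?_
    rw [hzero, mul_zero]
    intro hpi
    apply h
    rw [← (Finset.mem_filter.1 hp).2, Finset.card_image_of_injective _ hpi]
    simp

/-- The minor of `W` with row set `I` and column set `J`, or zero if these differ in size. -/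
noncomputable def minorOrZero {α β R : Type*} [LinearOrder α] [LinearOrder β] [CommRing R]
    (W : Matrix α β R) (I : Finset α) (J : Finset β) : R :=
  if h : I.card = J.card then W.setMinor I J rfl h.symm else 0

section minorOrZero

variable {α β γ R : Type*} [LinearOrder α] [LinearOrder β] [LinearOrder γ] [CommRing R]

theorem setMinor_eq_minorOrZero (W : Matrix α β R) {k : ℕ} (I : Finset α) (J : Finset β)
    (hI : I.card = k) (hJ : J.card = k) : W.setMinor I J hI hJ = W.minorOrZero I J := by
  subst hI
  rw [minorOrZero, dif_pos hJ.symm]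

/-- Thanks to the zero convention, Cauchy–Binet needs no size conditions: sets `K` of the wrong size
drop out. -/
theorem minorOrZero_mul [Fintype β] (A : Matrix α β R) (B : Matrix β γ R) (I : Finset α)
    (J : Finset γ) :
    (A * B).minorOrZero I J = ∑ K, A.minorOrZero I K * B.minorOrZero K J := by
  by_cases h : I.card = J.card
  · rw [minorOrZero, dif_pos h, setMinor]
    rw [show (A * B).submatrix (I.orderEmbOfFin rfl) (J.orderEmbOfFin h.symm) =
      A.submatrix (I.orderEmbOfFin rfl) id * B.submatrix id (J.orderEmbOfFin h.symm) from
        (submatrix_mul_equiv A B _ (Equiv.refl β) _).symm, det_mul_eq_sum_finset]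
    refine Finset.sum_congr rfl fun K _ => ?_
    split_ifs with hK
    · rw [← setMinor_eq_minorOrZero _ _ _ rfl hK, ← setMinor_eq_minorOrZero _ _ _ hK h.symm]
      rfl
    · rw [minorOrZero, dif_neg (fun h' => hK h'.symm), zero_mul]
  · rw [minorOrZero, dif_neg h]
    symm
    refine Finset.sum_eq_zero fun K _ => ?_
    by_cases hK : I.card = K.card
    · rw [minorOrZero.eq_1 B, dif_neg (fun h' => h (hK.trans h')), mul_zero]
    · rw [minorOrZero, dif_neg hK, zero_mul]

theorem minorOrZero_submatrix_orderIso {δ : Type*} [LinearOrder δ] (W : Matrix α β R) (e : γ ≃o α)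
    (e' : δ ≃o β) (I : Finset γ) (J : Finset δ) :
    (W.submatrix e e').minorOrZero I J =
      W.minorOrZero (I.map e.toEquiv.toEmbedding) (J.map e'.toEquiv.toEmbedding) := by
  by_cases h : I.card = J.card
  · rw [minorOrZero, dif_pos h, ← setMinor_eq_minorOrZero (k := I.card) W _ _ (by simp)
      (by simp [h]), setMinor, setMinor, submatrix_submatrix]
    congr 2
    · refine Finset.orderEmbOfFin_unique _ (fun x => ?_) ?_
      · exact Finset.mem_map_of_mem _ (Finset.orderEmbOfFin_mem _ _ _)
      · exact e.strictMono.comp (OrderEmbedding.strictMono _)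
    · refine Finset.orderEmbOfFin_unique _ (fun x => ?_) ?_
      · exact Finset.mem_map_of_mem _ (Finset.orderEmbOfFin_mem _ _ _)
      · exact e'.strictMono.comp (OrderEmbedding.strictMono _)
  · rw [minorOrZero, dif_neg h, minorOrZero, dif_neg (by simpa using h)]

theorem minorOrZero_eq_zero_of_row (W : Matrix α β R) (I : Finset α) (J : Finset β) {i : α}
    (hi : i ∈ I) (h : ∀ j ∈ J, W i j = 0) : W.minorOrZero I J = 0 := by
  rw [minorOrZero]
  split_ifs with hc
  · obtain ⟨a, rfl⟩ : i ∈ Set.range (I.orderEmbOfFin rfl) := by simpa using hi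
    exact det_eq_zero_of_row_eq_zero a fun b => h _ (Finset.orderEmbOfFin_mem _ _ _)
  · rfl

theorem minorOrZero_one (I J : Finset α) :
    (1 : Matrix α α R).minorOrZero I J = if I = J then 1 else 0 := by
  split_ifs with h
  · subst h
    rw [minorOrZero, dif_pos rfl, setMinor, submatrix_one _ (RelEmbedding.injective _), det_one]
  · by_cases hc : I.card = J.card
    · obtain ⟨i, hi, hiJ⟩ : ∃ i ∈ I, i ∉ J := by
        by_contra! hcon
        exact h (Finset.eq_of_subset_of_card_le hcon hc.ge)
      refine minorOrZero_eq_zero_of_row _ _ _ hi fun j hj => ?_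
      exact one_apply_ne fun hij => hiJ (hij ▸ hj)
    · rw [minorOrZero, dif_neg hc]

end minorOrZero

end Matrix

/-! ### Minors of the matrix of one column. -/

/-- `f` on `K` and `g` on `J` are injective with the same image. -/
structure IsLinked {σ τ L : Type*} (f : σ → L) (g : τ → L) (K : Finset σ) (J : Finset τ) :
    Prop where
  injOn_left : ∀ a ∈ K, ∀ b ∈ K, f a = f b → a = b
  injOn_right : ∀ a ∈ J, ∀ b ∈ J, g a = g b → a = b
  exists_right : ∀ a ∈ K, ∃ c ∈ J, g c = f a
  exists_left : ∀ c ∈ J, ∃ a ∈ K, f a = g c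

theorem IsLinked.image_eq {σ τ L : Type*} [DecidableEq L] {f : σ → L} {g : τ → L} {K : Finset σ}
    {J : Finset τ} (h : IsLinked f g K J) : K.image f = J.image g := by
  ext x
  simp only [Finset.mem_image]
  constructor
  · rintro ⟨a, ha, rfl⟩
    exact h.exists_right a ha
  · rintro ⟨a, ha, rfl⟩
    exact h.exists_left a ha

theorem IsLinked.card_eq {σ τ L : Type*} {f : σ → L} {g : τ → L} {K : Finset σ}
    {J : Finset τ} (h : IsLinked f g K J) : K.card = J.card := by
  classical
  rw [← Finset.card_image_of_injOn (s := K) (f := f) fun a ha b hb => h.injOn_left a ha b hb,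
    h.image_eq, Finset.card_image_of_injOn fun a ha b hb => h.injOn_right a ha b hb]

open Classical in
/-- The matrix of one column of a planar network: the strands `i` and `j` are joined if they meet
the column at the same point. -/
noncomputable def joinMatrix {σ τ L R : Type*} [CommRing R] (f : σ → L) (g : τ → L) (w : τ → R) :
    Matrix σ τ R :=
  Matrix.of fun i j => if f i = g j then w j else 0

-- Planarity fixes the sign here: if the sets are linked, the monotone maps list the common image in
-- the same increasing order, so the 0/1 part is the identity. Otherwise two rows or columns agree,
-- or a row vanishes.
open Classical in
theorem minorOrZero_joinMatrix {σ τ L R : Type*} [LinearOrder σ] [LinearOrder τ] [LinearOrder L]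
    [CommRing R] {f : σ → L} {g : τ → L} (hf : Monotone f) (hg : Monotone g) (w : τ → R)
    (K : Finset σ) (J : Finset τ) :
    (joinMatrix f g w).minorOrZero K J = if IsLinked f g K J then ∏ j ∈ J, w j else 0 := by
  by_cases hc : K.card = J.card
  swap
  · rw [Matrix.minorOrZero, dif_neg hc, if_neg fun h => hc h.card_eq]
  rw [Matrix.minorOrZero, dif_pos hc, Matrix.setMinor]
  set k := K.orderEmbOfFin rfl
  set l := J.orderEmbOfFin hc.symm
  have hk : ∀ a ∈ K, ∃ x, k x = a := fun a ha => by
    have : a ∈ Set.range k := by simpa [k] using ha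
    exact this
  have hl : ∀ a ∈ J, ∃ x, l x = a := fun a ha => by
    have : a ∈ Set.range l := by simpa [l] using ha
    exact this
  have hkm : ∀ x, k x ∈ K := Finset.orderEmbOfFin_mem _ _
  have hlm : ∀ x, l x ∈ J := Finset.orderEmbOfFin_mem _ _
  set N : Matrix (Fin K.card) (Fin K.card) R := Matrix.of fun a b =>
    if f (k a) = g (l b) then 1 else 0
  have hN : ((joinMatrix f g w).submatrix k l).det = (∏ j ∈ J, w j) * N.det := by
    have : (joinMatrix f g w).submatrix k l = Matrix.of fun a b => w (l b) * N a b := by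
      ext a b
      simp [joinMatrix, N]
    rw [this, Matrix.det_mul_row]
    congr 1
    refine Finset.prod_bij (fun x _ => l x) (fun x _ => hlm x)
      (fun x _ y _ h => l.injective h) (fun a ha => ?_) fun _ _ => rfl
    obtain ⟨x, hx⟩ := hl a ha
    exact ⟨x, Finset.mem_univ _, hx⟩
  rw [hN]
  by_cases h1 : ∀ a ∈ K, ∀ b ∈ K, f a = f b → a = b
  swap
  · rw [if_neg fun h => h1 h.injOn_left]
    push Not at h1
    obtain ⟨a, ha, b, hb, hab, hne⟩ := h1
    obtain ⟨x, rfl⟩ := hk a ha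
    obtain ⟨y, rfl⟩ := hk b hb
    rw [Matrix.det_zero_of_row_eq (i := x) (j := y) (fun h => hne (congrArg _ h)), mul_zero]
    ext z
    simp [N, hab]
  by_cases h2 : ∀ a ∈ J, ∀ b ∈ J, g a = g b → a = b
  swap
  · rw [if_neg fun h => h2 h.injOn_right]
    push Not at h2
    obtain ⟨a, ha, b, hb, hab, hne⟩ := h2
    obtain ⟨x, rfl⟩ := hl a ha
    obtain ⟨y, rfl⟩ := hl b hb
    rw [Matrix.det_zero_of_column_eq (i := x) (j := y) (fun h => hne (congrArg _ h)), mul_zero]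
    intro z
    simp [N, hab]
  by_cases h3 : ∀ a ∈ K, ∃ c ∈ J, g c = f a
  swap
  · rw [if_neg fun h => h3 h.exists_right]
    push Not at h3
    obtain ⟨a, ha, h⟩ := h3
    obtain ⟨x, rfl⟩ := hk a ha
    rw [Matrix.det_eq_zero_of_row_eq_zero x, mul_zero]
    intro z
    simp only [N, Matrix.of_apply]
    rw [if_neg fun h' => h _ (hlm z) h'.symm]
  have himg : K.image f = J.image g := by
    refine Finset.eq_of_subset_of_card_le ?_ ?_
    · intro x hx
      obtain ⟨a, ha, rfl⟩ := Finset.mem_image.1 hx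
      exact Finset.mem_image.2 (h3 a ha)
    · rw [Finset.card_image_of_injOn fun a ha b hb => h2 a ha b hb,
        Finset.card_image_of_injOn fun a ha b hb => h1 a ha b hb, hc]
  have h4 : ∀ c ∈ J, ∃ a ∈ K, f a = g c := fun c hc' => by
    have := Finset.mem_image_of_mem g hc'
    rw [← himg] at this
    exact Finset.mem_image.1 this
  have hfk : StrictMono fun x => f (k x) := (hf.comp k.monotone).strictMono_of_injective
    fun x y h => k.injective (h1 _ (hkm x) _ (hkm y) h)
  have hgl : StrictMono fun x => g (l x) := (hg.comp l.monotone).strictMono_of_injective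
    fun x y h => l.injective (h2 _ (hlm x) _ (hlm y) h)
  have hfg : (fun x => f (k x)) = fun x => g (l x) := by
    rw [← hfk.range_inj hgl]
    ext x
    constructor
    · rintro ⟨y, rfl⟩
      obtain ⟨c, hc', h⟩ := h3 _ (hkm y)
      obtain ⟨z, rfl⟩ := hl c hc'
      exact ⟨z, h⟩
    · rintro ⟨y, rfl⟩
      obtain ⟨c, hc', h⟩ := h4 _ (hlm y)
      obtain ⟨z, rfl⟩ := hk c hc'
      exact ⟨z, h⟩
  have hN1 : N = 1 := by
    ext a b
    simp only [N, Matrix.of_apply, Matrix.one_apply]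
    refine if_congr ?_ rfl rfl
    rw [show f (k a) = g (l a) from congrFun hfg a]
    exact ⟨fun h => hgl.injective h, fun h => by rw [h]⟩
  rw [if_pos ⟨h1, h2, h3, h4⟩, hN1, Matrix.det_one, mul_one]

/-! ### Exchanging two families along components, at one column. -/

section exchange

variable {σ τ L : Type*}

open Classical in
/-- The set obtained from `K` by replacing its part inside `U` with that of `K'`. -/
noncomputable def exchange (U : Set σ) (K K' : Finset σ) : Finset σ :=
  K.filter (· ∉ U) ∪ K'.filter (· ∈ U)

theorem mem_exchange {U : Set σ} {K K' : Finset σ} {a : σ} :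
    a ∈ exchange U K K' ↔ (a ∉ U ∧ a ∈ K) ∨ (a ∈ U ∧ a ∈ K') := by
  simp [exchange, and_comm]

theorem exchange_exchange (U : Set σ) (K K' : Finset σ) :
    exchange U (exchange U K K') (exchange U K' K) = K := by
  ext a
  by_cases ha : a ∈ U <;> simp [mem_exchange, ha]

/-- Exactly one of `K` and `K'` contains `a`. -/
def IsSingle (K K' : Finset σ) (a : σ) : Prop :=
  (a ∈ K ∧ a ∉ K') ∨ (a ∈ K' ∧ a ∉ K)

theorem IsSingle.symm {K K' : Finset σ} {a : σ} (h : IsSingle K K' a) : IsSingle K' K a :=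
  Or.symm h

/-- An exchange alters which family owns a strand, not whether exactly one does; so the components
survive it. -/
theorem isSingle_exchange (U : Set σ) (K K' : Finset σ) :
    IsSingle (exchange U K K') (exchange U K' K) = IsSingle K K' := by
  ext a
  by_cases ha : a ∈ U <;> simp [IsSingle, mem_exchange, ha, or_comm]

theorem exchange_eq_left {U : Set σ} {K K' : Finset σ} (h : ∀ a, IsSingle K K' a → a ∉ U) :
    exchange U K K' = K := by
  ext a
  have := h a
  simp only [mem_exchange, IsSingle] at *
  tauto

theorem exchange_eq_right {U : Set σ} {K K' : Finset σ} (h : ∀ a, IsSingle K K' a → a ∈ U) :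
    exchange U K K' = K' := by
  ext a
  have := h a
  simp only [mem_exchange, IsSingle] at *
  tauto

theorem prod_exchange_mul_prod_exchange [Fintype σ] {R : Type*} [CommMonoid R] (w : σ → R)
    (U : Set σ) (K K' : Finset σ) :
    (∏ j ∈ exchange U K K', w j) * ∏ j ∈ exchange U K' K, w j =
      (∏ j ∈ K, w j) * ∏ j ∈ K', w j := by
  classical
  have h : ∀ K : Finset σ, ∏ j ∈ K, w j = ∏ j, if j ∈ K then w j else 1 := fun K => by
    rw [Finset.prod_ite_mem, Finset.univ_inter]
  simp only [h, ← Finset.prod_mul_distrib]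
  refine Finset.prod_congr rfl fun j _ => ?_
  by_cases hj : j ∈ U <;> simp [mem_exchange, hj, mul_comm]

/-- The sets `U` and `V` of strands, on the two sides of a column, are unions of parts of
components of the superposition of two families of paths, where `D` and `D'` are the sets of
strands that belong to just one of the two families. -/
structure IsClosedAt (f : σ → L) (g : τ → L) (D : σ → Prop) (D' : τ → Prop) (U : Set σ)
    (V : Set τ) : Prop where
  left : ∀ a b, D a → D b → f a = f b → a ∈ U → b ∈ U
  right : ∀ a b, D' a → D' b → g a = g b → a ∈ V → b ∈ V
  through : ∀ a c, D a → D' c → f a = g c → (∀ b, D b → f b = f a → b = a) →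
    (∀ d, D' d → g d = g c → d = c) → (a ∈ U ↔ c ∈ V)

theorem IsClosedAt.symm {f : σ → L} {g : τ → L} {D : σ → Prop} {D' : τ → Prop} {U : Set σ}
    {V : Set τ} (h : IsClosedAt f g D D' U V) : IsClosedAt g f D' D V U :=
  ⟨h.right, h.left, fun c a hc ha he h1 h2 => (h.through a c ha hc he.symm h2 h1).symm⟩

theorem IsLinked.symm {f : σ → L} {g : τ → L} {K : Finset σ} {J : Finset τ}
    (h : IsLinked f g K J) : IsLinked g f J K :=
  ⟨h.injOn_right, h.injOn_left, h.exists_left, h.exists_right⟩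

/-- If strands from different families met at a point after the exchange, both would be single,
hence in the same component, hence both exchanged or both kept. -/
theorem IsLinked.injOn_exchange {f : σ → L} {g : τ → L} {K K' : Finset σ} {J J' : Finset τ}
    (h : IsLinked f g K J) (h' : IsLinked f g K' J') {U : Set σ} {V : Set τ}
    (hc : IsClosedAt f g (IsSingle K K') (IsSingle J J') U V) :
    ∀ a ∈ exchange U K K', ∀ b ∈ exchange U K K', f a = f b → a = b := by
  have key : ∀ a b, a ∉ U → b ∈ U → a ∈ K → b ∈ K' → f a = f b → a = b := by
    intro a b ha hb haK hbK hab
    by_contra hne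
    have h1 : a ∉ K' := fun h1 => hne (h'.injOn_left a h1 b hbK hab)
    have h2 : b ∉ K := fun h2 => hne (h.injOn_left a haK b h2 hab)
    exact ha (hc.left b a (Or.inr ⟨hbK, h2⟩) (Or.inl ⟨haK, h1⟩) hab.symm hb)
  intro a ha b hb hab
  rw [mem_exchange] at ha hb
  rcases ha with ⟨ha, haK⟩ | ⟨ha, haK⟩ <;> rcases hb with ⟨hb, hbK⟩ | ⟨hb, hbK⟩
  · exact h.injOn_left a haK b hbK hab
  · exact key a b ha hb haK hbK hab
  · exact (key b a hb ha hbK haK hab.symm).symm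
  · exact h'.injOn_left a haK b hbK hab

/-- If both families pass the point, their outgoing strands coincide or lie in `V` together, so
either choice leaves one of them. If only one family passes, `through` carries membership in `U`
over to `V`. -/
theorem IsLinked.exists_right_exchange {f : σ → L} {g : τ → L} {K K' : Finset σ}
    {J J' : Finset τ} (h : IsLinked f g K J) (h' : IsLinked f g K' J') {U : Set σ} {V : Set τ}
    (hc : IsClosedAt f g (IsSingle K K') (IsSingle J J') U V) (a : σ) (haK : a ∈ K) :
    (a ∉ U → ∃ c ∈ exchange V J J', g c = f a) ∧ (a ∈ U → ∃ c ∈ exchange V J' J, g c = f a) := by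
  obtain ⟨c, hcJ, hca⟩ := h.exists_right a haK
  suffices hs : ∀ c' ∈ J', g c' = f a → c' ≠ c → (c ∈ V → c' ∈ V) ∧ (c' ∈ V → c ∈ V) by
    by_cases h1 : ∃ c' ∈ J', g c' = f a
    · obtain ⟨c', hc', hca'⟩ := h1
      by_cases hcc : c' = c
      · subst hcc
        constructor <;> intro _ <;> refine ⟨c', ?_, hca⟩ <;> rw [mem_exchange] <;> tauto
      · have := hs c' hc' hca' hcc
        by_cases hV : c ∈ V
        · exact ⟨fun _ => ⟨c', mem_exchange.2 (Or.inr ⟨this.1 hV, hc'⟩), hca'⟩,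
            fun _ => ⟨c, mem_exchange.2 (Or.inr ⟨hV, hcJ⟩), hca⟩⟩
        · exact ⟨fun _ => ⟨c, mem_exchange.2 (Or.inl ⟨hV, hcJ⟩), hca⟩,
            fun _ => ⟨c', mem_exchange.2 (Or.inl ⟨fun h => hV (this.2 h), hc'⟩), hca'⟩⟩
    · have hK' : ∀ b ∈ K', f b ≠ f a := fun b hb hba => by
        obtain ⟨d, hd, hdb⟩ := h'.exists_right b hb
        exact h1 ⟨d, hd, hdb.trans hba⟩
      have hth := hc.through a c (Or.inl ⟨haK, fun hk => hK' a hk rfl⟩)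
        (Or.inl ⟨hcJ, fun hj => h1 ⟨c, hj, hca⟩⟩) hca.symm
        (by
          rintro b (⟨hb, -⟩ | ⟨hb, -⟩) hba
          · exact h.injOn_left b hb a haK hba
          · exact absurd hba (hK' b hb))
        (by
          rintro d (⟨hd, -⟩ | ⟨hd, -⟩) hdc
          · exact h.injOn_right d hd c hcJ hdc
          · exact absurd ⟨d, hd, hdc.trans hca⟩ h1)
      constructor <;> intro ha <;> refine ⟨c, ?_, hca⟩ <;> rw [mem_exchange] <;> tauto
  intro c' hc' hca' hne
  have h1 : IsSingle J J' c :=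
    Or.inl ⟨hcJ, fun hj => hne (h'.injOn_right c' hc' c hj (hca'.trans hca.symm))⟩
  have h2 : IsSingle J J' c' :=
    Or.inr ⟨hc', fun hj => hne (h.injOn_right c' hj c hcJ (hca'.trans hca.symm))⟩
  exact ⟨hc.right c c' h1 h2 (hca.trans hca'.symm), hc.right c' c h2 h1 (hca'.trans hca.symm)⟩

theorem IsClosedAt.swap {f : σ → L} {g : τ → L} {K K' : Finset σ} {J J' : Finset τ} {U : Set σ}
    {V : Set τ} (hc : IsClosedAt f g (IsSingle K K') (IsSingle J J') U V) :
    IsClosedAt f g (IsSingle K' K) (IsSingle J' J) U V := by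
  have h1 : IsSingle K' K = IsSingle K K' := funext fun a => propext or_comm
  have h2 : IsSingle J' J = IsSingle J J' := funext fun a => propext or_comm
  rwa [h1, h2]

theorem IsLinked.exchange {f : σ → L} {g : τ → L} {K K' : Finset σ} {J J' : Finset τ}
    (h : IsLinked f g K J) (h' : IsLinked f g K' J') {U : Set σ} {V : Set τ}
    (hc : IsClosedAt f g (IsSingle K K') (IsSingle J J') U V) :
    IsLinked f g (exchange U K K') (exchange V J J') := by
  refine ⟨h.injOn_exchange h' hc, h.symm.injOn_exchange h'.symm hc.symm, fun a ha => ?_,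
    fun a ha => ?_⟩
  · rcases mem_exchange.1 ha with ⟨ha, haK⟩ | ⟨ha, haK⟩
    · exact (h.exists_right_exchange h' hc a haK).1 ha
    · exact (h'.exists_right_exchange h hc.swap a haK).2 ha
  · rcases mem_exchange.1 ha with ⟨ha, haK⟩ | ⟨ha, haK⟩
    · exact (h.symm.exists_right_exchange h'.symm hc.symm a haK).1 ha
    · exact (h'.symm.exists_right_exchange h.symm hc.swap.symm a haK).2 ha

theorem card_filter_fiber [DecidableEq L] {f : σ → L} {K : Finset σ}
    (h : ∀ a ∈ K, ∀ b ∈ K, f a = f b → a = b) {a : σ} (ha : a ∈ K) {p : L} (hp : f a = p)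
    (P : σ → Prop) [DecidablePred P] :
    (K.filter fun b => f b = p ∧ P b).card = if P a then 1 else 0 := by
  subst hp
  have : (K.filter fun b => f b = f a ∧ P b) = if P a then {a} else ∅ := by
    ext b
    split_ifs with hPa
    · simp only [Finset.mem_filter, Finset.mem_singleton]
      exact ⟨fun hb => h b hb.1 a ha hb.2.1, by rintro rfl; exact ⟨ha, rfl, hPa⟩⟩
    · simp only [Finset.mem_filter, Finset.notMem_empty, iff_false]
      rintro ⟨hb, hba, hPb⟩
      exact hPa (h b hb a ha hba ▸ hPb)
  rw [this]
  split_ifs <;> simp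

theorem IsLinked.card_filter_eq [LinearOrder L] {f : σ → L} {g : τ → L} {K : Finset σ} {J : Finset τ}
    (h : IsLinked f g K J) (p : L) :
    (K.filter (f · < p)).card = (J.filter (g · < p)).card := by
  rw [← Finset.card_image_of_injOn (s := K.filter (f · < p)) (f := f) fun a ha b hb =>
      h.injOn_left a (Finset.mem_filter.1 ha).1 b (Finset.mem_filter.1 hb).1,
    ← Finset.card_image_of_injOn (s := J.filter (g · < p)) (f := g) fun a ha b hb =>
      h.injOn_right a (Finset.mem_filter.1 ha).1 b (Finset.mem_filter.1 hb).1,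
    ← Finset.filter_image (p := (· < p)), ← Finset.filter_image (p := (· < p)), h.image_eq]

/-- The level on both sides of the point `p` of a column. -/
def columnLevel [LinearOrder L] (f : σ → L) (K K' : Finset σ) (p : L) : ℤ :=
  (K.filter (f · < p)).card - (K'.filter (f · < p)).card

/-- A family meets a column at the same points from either side, so the height just above a point
can be read in either layer. -/
theorem IsLinked.columnLevel_eq [LinearOrder L] {f : σ → L} {g : τ → L} {K K' : Finset σ} {J J' : Finset τ}
    (h : IsLinked f g K J) (h' : IsLinked f g K' J') (p : L) :
    columnLevel f K K' p = columnLevel g J J' p := by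
  rw [columnLevel, columnLevel, h.card_filter_eq, h'.card_filter_eq]

end exchange

/-! ### The level is constant along components. -/

section level

variable {σ τ L : Type*} [LinearOrder σ] [LinearOrder τ] [LinearOrder L]

/-- The level of the contour line that passes through the strand `a` in the superposition of two
families of paths, which run through the sets `K` and `K'` of strands. -/
def level (K K' : Finset σ) (a : σ) : ℤ :=
  (K.filter (· < a)).card - (K'.filter (· ≤ a)).card

theorem card_filter_eq_add_of_forall {f : σ → L} (hf : Monotone f) (K : Finset σ) (a : σ)
    (P : σ → Prop) [DecidablePred P] (hP : ∀ b, P b → b ≤ a) (hP' : ∀ b, b < a → P b) :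
    (K.filter P).card = (K.filter (f · < f a)).card +
      (K.filter fun b => f b = f a ∧ P b).card := by
  rw [← Finset.card_union_of_disjoint]
  · congr 1
    ext b
    simp only [Finset.mem_filter, Finset.mem_union]
    constructor
    · rintro ⟨hb, hPb⟩
      rcases (hf (hP b hPb)).lt_or_eq with h | h
      · exact Or.inl ⟨hb, h⟩
      · exact Or.inr ⟨hb, h, hPb⟩
    · rintro (⟨hb, h⟩ | ⟨hb, -, h⟩)
      · exact ⟨hb, hP' b (hf.reflect_lt h)⟩
      · exact ⟨hb, h⟩
  · rw [Finset.disjoint_filter]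
    intro b _ h h'
    exact h.ne h'.1

theorem level_eq {f : σ → L} (hf : Monotone f) (K K' : Finset σ) (a : σ) :
    level K K' a = columnLevel f K K' (f a) + (K.filter fun b => f b = f a ∧ b < a).card -
      (K'.filter fun b => f b = f a ∧ b ≤ a).card := by
  rw [level, columnLevel, card_filter_eq_add_of_forall hf K a (· < a) (fun _ h => h.le)
    (fun _ h => h), card_filter_eq_add_of_forall hf K' a (· ≤ a) (fun _ h => h)
    (fun _ h => h.le)]
  push_cast
  ring

/-- Distinct single strands at one point belong to different families. The lower one undoes the
change of height made by the upper one, so both separate the same two heights. -/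
theorem level_eq_of_eq {f : σ → L} (hf : Monotone f) {K K' : Finset σ}
    (h : ∀ a ∈ K, ∀ b ∈ K, f a = f b → a = b) (h' : ∀ a ∈ K', ∀ b ∈ K', f a = f b → a = b)
    {a b : σ} (ha : IsSingle K K' a) (hb : IsSingle K K' b) (hab : f a = f b) :
    level K K' a = level K K' b := by
  have key : ∀ a b, a ∈ K → a ∉ K' → b ∈ K' → b ∉ K → f a = f b →
      level K K' a = level K K' b := by
    intro a b ha ha' hb hb' hab
    have hne : a ≠ b := by
      rintro rfl
      exact hb' ha
    rw [level_eq hf, level_eq hf, card_filter_fiber h ha rfl, card_filter_fiber h' hb hab.symm,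
      card_filter_fiber h ha hab, card_filter_fiber h' hb rfl, hab]
    rcases lt_or_gt_of_ne hne with hlt | hlt
    · simp [hlt, hlt.not_ge]
    · simp [hlt.le, hlt.not_gt]
  rcases ha with ⟨ha, ha'⟩ | ⟨ha, ha'⟩ <;> rcases hb with ⟨hb, hb'⟩ | ⟨hb, hb'⟩
  · rw [h a ha b hb hab]
  · exact key a b ha ha' hb hb' hab
  · exact (key b a hb hb' ha ha' hab.symm).symm
  · rw [h' a ha b hb hab]

/-- Here no other strand of either family meets the point, so `columnLevel` is the height above `a`;
a strand of `K'` lowers it by one. -/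
theorem level_eq_columnLevel {f : σ → L} (hf : Monotone f) {K K' : Finset σ}
    (h : ∀ a ∈ K, ∀ b ∈ K, f a = f b → a = b) (h' : ∀ a ∈ K', ∀ b ∈ K', f a = f b → a = b)
    {a : σ} (ha : IsSingle K K' a) (hu : ∀ b, IsSingle K K' b → f b = f a → b = a) :
    level K K' a = columnLevel f K K' (f a) - if a ∈ K then 0 else 1 := by
  rcases ha with ⟨ha, ha'⟩ | ⟨ha, ha'⟩
  · have : (K'.filter fun b => f b = f a ∧ b ≤ a) = ∅ := by
      rw [Finset.filter_eq_empty_iff]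
      rintro b hb ⟨hba, -⟩
      by_cases hbK : b ∈ K
      · exact ha' (h b hbK a ha hba ▸ hb)
      · exact ha' (hu b (Or.inr ⟨hb, hbK⟩) hba ▸ hb)
    rw [level_eq hf, card_filter_fiber h ha rfl, this]
    simp [ha]
  · have : (K.filter fun b => f b = f a ∧ b < a) = ∅ := by
      rw [Finset.filter_eq_empty_iff]
      rintro b hb ⟨hba, -⟩
      by_cases hbK : b ∈ K'
      · exact ha' (h' b hbK a ha hba ▸ hb)
      · exact ha' (hu b (Or.inl ⟨hb, hbK⟩) hba ▸ hb)
    rw [level_eq hf, card_filter_fiber h' ha rfl, this]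
    simp [ha']

theorem IsLinked.isClosedAt_level_neg {f : σ → L} {g : τ → L} (hf : Monotone f)
    (hg : Monotone g) {K K' : Finset σ} {J J' : Finset τ} (h : IsLinked f g K J)
    (h' : IsLinked f g K' J') :
    IsClosedAt f g (IsSingle K K') (IsSingle J J') {a | level K K' a < 0}
      {c | level J J' c < 0} := by
  refine ⟨fun a b ha hb hab hlt => ?_, fun a b ha hb hab hlt => ?_, fun a c ha hc hac hu hu' => ?_⟩
  · exact (level_eq_of_eq hf h.injOn_left h'.injOn_left ha hb hab).symm.trans_lt hlt
  · exact (level_eq_of_eq hg h.injOn_right h'.injOn_right ha hb hab).symm.trans_lt hlt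
  -- A component that passes straight through stays in one family.
  · have hiff : a ∈ K ↔ c ∈ J := by
      constructor
      · intro haK
        obtain ⟨d, hd, hda⟩ := h.exists_right a haK
        by_contra hcJ
        by_cases hdJ : d ∈ J'
        · have hcJ' : c ∈ J' := by
            rcases hc with hc | hc
            · exact absurd hc.1 hcJ
            · exact hc.1
          exact hcJ (h'.injOn_right d hdJ c hcJ' (hda.trans hac) ▸ hd)
        · exact hcJ (hu' d (Or.inl ⟨hd, hdJ⟩) (hda.trans hac) ▸ hd)
      · intro hcJ
        obtain ⟨d, hd, hda⟩ := h.exists_left c hcJ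
        by_contra haK
        by_cases hdJ : d ∈ K'
        · have haK' : a ∈ K' := by
            rcases ha with ha | ha
            · exact absurd ha.1 haK
            · exact ha.1
          exact haK (h'.injOn_left d hdJ a haK' (hda.trans hac.symm) ▸ hd)
        · exact haK (hu d (Or.inl ⟨hd, hdJ⟩) (hda.trans hac.symm) ▸ hd)
    have : level K K' a = level J J' c := by
      rw [level_eq_columnLevel hf h.injOn_left h'.injOn_left ha hu,
        level_eq_columnLevel hg h.injOn_right h'.injOn_right hc hu', h.columnLevel_eq h', hac]
      simp only [hiff]
    simp only [Set.mem_ofPred_eq, this]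

end level

/-! ### Families of disjoint paths through all layers, and the injection. -/

section layers

variable {σ : ℕ → Type*} {L R : Type*} [CommRing R]

/-- The product of the first matrices of a sequence of rectangular matrices. -/
def layerProd [∀ k, Fintype (σ k)] [DecidableEq (σ 0)]
    (M : ∀ k, Matrix (σ k) (σ (k + 1)) R) : ∀ k, Matrix (σ 0) (σ k) R
  | 0 => 1
  | k + 1 => layerProd M k * M k

/-- A family of disjoint paths through the layers `0, …, N`, given by the sets of strands that it
uses. -/
structure IsFamily (f : ∀ k, σ k → L) (g : ∀ k, σ (k + 1) → L) (N : ℕ) (I : Finset (σ 0))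
    (J : Finset (σ N)) (S : ∀ k, Finset (σ k)) : Prop where
  eq_empty : ∀ k, N < k → S k = ∅
  first_eq : S 0 = I
  last_eq : S N = J
  isLinked : ∀ k < N, IsLinked (f k) (g k) (S k) (S (k + 1))

/-- The default value `∅` beyond layer `N` leaves only finitely many sets to choose. -/
theorem finite_setOf_isFamily [∀ k, Fintype (σ k)] (f : ∀ k, σ k → L) (g : ∀ k, σ (k + 1) → L)
    (N : ℕ) (I : Finset (σ 0)) (J : Finset (σ N)) : {S | IsFamily f g N I J S}.Finite := by
  refine Set.Finite.of_injOn (t := Set.univ)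
    (f := fun S => fun k : Fin (N + 1) => (S k : Finset (σ k))) (fun _ _ => Set.mem_univ _) ?_
    Set.finite_univ
  intro S hS S' hS' h
  funext k
  by_cases hk : N < k
  · rw [hS.eq_empty k hk, hS'.eq_empty k hk]
  · exact congrFun h ⟨k, by omega⟩

/-- The finite set of all families of disjoint paths with given end sets. -/
noncomputable def families [∀ k, Fintype (σ k)] (f : ∀ k, σ k → L) (g : ∀ k, σ (k + 1) → L)
    (N : ℕ) (I : Finset (σ 0)) (J : Finset (σ N)) : Finset (∀ k, Finset (σ k)) :=
  (finite_setOf_isFamily f g N I J).toFinset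

theorem mem_families [∀ k, Fintype (σ k)] {f : ∀ k, σ k → L} {g : ∀ k, σ (k + 1) → L}
    {N : ℕ} {I : Finset (σ 0)} {J : Finset (σ N)} {S : ∀ k, Finset (σ k)} :
    S ∈ families f g N I J ↔ IsFamily f g N I J S := by
  simp [families]

/-- The weight of a family of paths. -/
def familyWeight (w : ∀ k, σ (k + 1) → R) (N : ℕ) (S : ∀ k, Finset (σ k)) : R :=
  ∏ k ∈ Finset.range N, ∏ j ∈ S (k + 1), w k j

/-- Lindström's lemma: Cauchy–Binet sums over the strands used in each layer, and each column
contributes a monomial or zero. -/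
theorem minorOrZero_layerProd [∀ k, Fintype (σ k)] [∀ k, LinearOrder (σ k)] [LinearOrder L]
    {f : ∀ k, σ k → L} {g : ∀ k, σ (k + 1) → L} (hf : ∀ k, Monotone (f k))
    (hg : ∀ k, Monotone (g k)) (w : ∀ k, σ (k + 1) → R) (N : ℕ) (I : Finset (σ 0))
    (J : Finset (σ N)) :
    (layerProd (fun k => joinMatrix (f k) (g k) (w k)) N).minorOrZero I J =
      ∑ S ∈ families f g N I J, familyWeight w N S := by
  classical
  induction N with
  | zero =>
    rw [layerProd, Matrix.minorOrZero_one]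
    split_ifs with h
    · subst h
      have : families f g 0 I I = {Function.update (fun _ => ∅) 0 I} := by
        ext S
        rw [mem_families, Finset.mem_singleton]
        constructor
        · intro h
          funext k
          by_cases hk : k = 0
          · subst hk
            rw [Function.update_self, h.first_eq]
          · rw [Function.update_of_ne hk, h.eq_empty k (Nat.pos_of_ne_zero hk)]
        · rintro rfl
          refine ⟨fun k hk => ?_, ?_, ?_, fun k hk => absurd hk (Nat.not_lt_zero k)⟩
          · rw [Function.update_of_ne hk.ne']
          · rw [Function.update_self]
          · rw [Function.update_self]
      simp [this, familyWeight]
    · symm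
      refine Finset.sum_eq_zero fun S hS => absurd ?_ h
      have := mem_families.1 hS
      exact this.first_eq.symm.trans this.last_eq
  | succ N ih =>
    rw [layerProd, Matrix.minorOrZero_mul,
      ← Finset.sum_fiberwise_of_maps_to (s := families f g (N + 1) I J) (t := Finset.univ)
        (g := fun S => S N) (fun _ _ => Finset.mem_univ _)]
    refine Finset.sum_congr rfl fun K _ => ?_
    rw [ih, minorOrZero_joinMatrix (hf N) (hg N)]
    split_ifs with hKJ
    · rw [Finset.sum_mul]
      -- Families are prolonged by `J`, and truncated by restoring the default `∅` in layer `N + 1`.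
      refine Finset.sum_bij' (fun S _ => Function.update S (N + 1) J)
        (fun S _ => Function.update S (N + 1) ∅) ?_ ?_ ?_ ?_ ?_
      · intro S hS
        have h := mem_families.1 hS
        rw [Finset.mem_filter, mem_families]
        refine ⟨⟨fun k hk => ?_, ?_, ?_, fun k hk => ?_⟩, ?_⟩
        · rw [Function.update_of_ne hk.ne', h.eq_empty k (by omega)]
        · rw [Function.update_of_ne (by omega), h.first_eq]
        · rw [Function.update_self]
        · rw [Function.update_of_ne hk.ne]
          rcases (Nat.lt_succ_iff_lt_or_eq.1 hk) with hk' | rfl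
          · rw [Function.update_of_ne (by omega)]
            exact h.isLinked k hk'
          · rw [Function.update_self, h.last_eq]
            exact hKJ
        · rw [Function.update_of_ne (by omega), h.last_eq]
      · intro S hS
        rw [Finset.mem_filter, mem_families] at hS
        obtain ⟨h, hK⟩ := hS
        rw [mem_families]
        refine ⟨fun k hk => ?_, ?_, ?_, fun k hk => ?_⟩
        · by_cases hk' : k = N + 1
          · subst hk'
            rw [Function.update_self]
          · rw [Function.update_of_ne hk', h.eq_empty k (by omega)]
        · rw [Function.update_of_ne (by omega), h.first_eq]
        · rw [Function.update_of_ne (by omega), hK]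
        · rw [Function.update_of_ne (by omega), Function.update_of_ne (by omega)]
          exact h.isLinked k (by omega)
      · intro S hS
        have h := mem_families.1 hS
        simp only [Function.update_idem]
        rw [← h.eq_empty (N + 1) (by omega), Function.update_eq_self]
      · intro S hS
        rw [Finset.mem_filter, mem_families] at hS
        simp only [Function.update_idem]
        rw [← hS.1.last_eq, Function.update_eq_self]
      · intro S hS
        rw [familyWeight, familyWeight, Finset.prod_range_succ, Function.update_self]
        congr 1
        refine Finset.prod_congr rfl fun k hk => ?_
        rw [Function.update_of_ne]
        have := Finset.mem_range.1 hk
        omega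
    · rw [mul_zero]
      symm
      refine Finset.sum_eq_zero fun S hS => absurd ?_ hKJ
      rw [Finset.mem_filter, mem_families] at hS
      rw [← hS.2, ← hS.1.last_eq]
      exact hS.1.isLinked N (by omega)

/-- The family `U` of sets of strands is a union of components of the superposition of two
families of paths, where `D` describes the strands that belong to just one of the two. -/
def IsClosedFamily (f : ∀ k, σ k → L) (g : ∀ k, σ (k + 1) → L) (N : ℕ) (D : ∀ k, σ k → Prop)
    (U : ∀ k, Set (σ k)) : Prop :=
  ∀ k < N, IsClosedAt (f k) (g k) (D k) (D (k + 1)) (U k) (U (k + 1))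

/-- The union of the components that end on the right boundary. -/
def rightHull (f : ∀ k, σ k → L) (g : ∀ k, σ (k + 1) → L) (N : ℕ) (D : ∀ k, σ k → Prop) (k : ℕ) :
    Set (σ k) :=
  {a | ∀ U : ∀ k, Set (σ k), IsClosedFamily f g N D U → (∀ b, D N b → b ∈ U N) → a ∈ U k}

theorem isClosedFamily_rightHull (f : ∀ k, σ k → L) (g : ∀ k, σ (k + 1) → L) (N : ℕ)
    (D : ∀ k, σ k → Prop) : IsClosedFamily f g N D (rightHull f g N D) := by
  refine fun k hk => ⟨fun a b ha hb hab h U hU hN => ?_, fun a b ha hb hab h U hU hN => ?_,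
    fun a c ha hc hac hu hu' => ⟨fun h U hU hN => ?_, fun h U hU hN => ?_⟩⟩
  · exact (hU k hk).left a b ha hb hab (h U hU hN)
  · exact (hU k hk).right a b ha hb hab (h U hU hN)
  · exact ((hU k hk).through a c ha hc hac hu hu').1 (h U hU hN)
  · exact ((hU k hk).through a c ha hc hac hu hu').2 (h U hU hN)

/-- Exchange of two families of paths on the components that end on the right boundary. -/
noncomputable def exchangeRight (f : ∀ k, σ k → L) (g : ∀ k, σ (k + 1) → L) (N : ℕ)
    (S : (∀ k, Finset (σ k)) × ∀ k, Finset (σ k)) : (∀ k, Finset (σ k)) × ∀ k, Finset (σ k) :=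
  (fun k => exchange (rightHull f g N (fun k => IsSingle (S.1 k) (S.2 k)) k) (S.1 k) (S.2 k),
    fun k => exchange (rightHull f g N (fun k => IsSingle (S.1 k) (S.2 k)) k) (S.2 k) (S.1 k))

/-- The hull depends only on `IsSingle`, so the second exchange acts on the same strands. -/
theorem exchangeRight_involutive (f : ∀ k, σ k → L) (g : ∀ k, σ (k + 1) → L) (N : ℕ) :
    Function.Involutive (exchangeRight f g N) := by
  intro S
  have h : (fun k => IsSingle ((exchangeRight f g N S).1 k) ((exchangeRight f g N S).2 k)) =
      fun k => IsSingle (S.1 k) (S.2 k) := funext fun k => isSingle_exchange _ _ _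
  refine Prod.ext (funext fun k => ?_) (funext fun k => ?_)
  · rw [exchangeRight, h]
    exact exchange_exchange _ _ _
  · rw [exchangeRight, h]
    exact exchange_exchange _ _ _

theorem familyWeight_exchangeRight [∀ k, Fintype (σ k)] (f : ∀ k, σ k → L)
    (g : ∀ k, σ (k + 1) → L) (w : ∀ k, σ (k + 1) → R) (N : ℕ)
    (S : (∀ k, Finset (σ k)) × ∀ k, Finset (σ k)) :
    familyWeight w N (exchangeRight f g N S).1 * familyWeight w N (exchangeRight f g N S).2 =
      familyWeight w N S.1 * familyWeight w N S.2 := by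
  simp only [familyWeight, ← Finset.prod_mul_distrib]
  exact Finset.prod_congr rfl fun k _ => prod_exchange_mul_prod_exchange (w k) _ _ _

theorem IsFamily.exchangeRight [∀ k, LinearOrder (σ k)] [LinearOrder L]
    {f : ∀ k, σ k → L} {g : ∀ k, σ (k + 1) → L} (hf : ∀ k, Monotone (f k))
    (hg : ∀ k, Monotone (g k)) {N : ℕ} {I I' : Finset (σ 0)} {J J' : Finset (σ N)}
    (hI : ∀ a, IsSingle I I' a → 0 ≤ level I I' a) (hJ : ∀ a, IsSingle J J' a → level J J' a < 0)
    {S : (∀ k, Finset (σ k)) × ∀ k, Finset (σ k)} (h : IsFamily f g N I J S.1)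
    (h' : IsFamily f g N I' J' S.2) :
    IsFamily f g N I J' (exchangeRight f g N S).1 ∧
      IsFamily f g N I' J (exchangeRight f g N S).2 := by
  have hc := isClosedFamily_rightHull f g N (fun k => IsSingle (S.1 k) (S.2 k))
  have h0 : ∀ a, IsSingle (S.1 0) (S.2 0) a →
      a ∉ rightHull f g N (fun k => IsSingle (S.1 k) (S.2 k)) 0 := by
    intro a ha hm
    -- The strands of negative level form a closed family containing all right ends, hence
    -- containing the hull; left ends have nonnegative level.
    have := hm (fun k => {a | level (S.1 k) (S.2 k) a < 0})
      (fun k hk => (h.isLinked k hk).isClosedAt_level_neg (hf k) (hg k) (h'.isLinked k hk))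
      (fun b hb => by
        replace hb : IsSingle (S.1 N) (S.2 N) b := hb
        rw [h.last_eq, h'.last_eq] at hb
        rw [Set.mem_ofPred_eq, h.last_eq, h'.last_eq]
        exact hJ b hb)
    rw [Set.mem_ofPred_eq] at this
    rw [h.first_eq, h'.first_eq] at this ha
    exact absurd this (hI a ha).not_gt
  have hN : ∀ a, IsSingle (S.1 N) (S.2 N) a →
      a ∈ rightHull f g N (fun k => IsSingle (S.1 k) (S.2 k)) N := fun a ha U _ hU => hU a ha
  refine ⟨⟨fun k hk => ?_, ?_, ?_, fun k hk => ?_⟩, ⟨fun k hk => ?_, ?_, ?_, fun k hk => ?_⟩⟩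
  · simp only [_root_.exchangeRight]
    rw [h.eq_empty k hk, h'.eq_empty k hk]
    exact exchange_eq_left fun a ha => by simp [IsSingle] at ha
  · exact (exchange_eq_left h0).trans h.first_eq
  · exact (exchange_eq_right hN).trans h'.last_eq
  · exact (h.isLinked k hk).exchange (h'.isLinked k hk) (hc k hk)
  · simp only [_root_.exchangeRight]
    rw [h.eq_empty k hk, h'.eq_empty k hk]
    exact exchange_eq_left fun a ha => by simp [IsSingle] at ha
  · exact (exchange_eq_left fun a ha => h0 a ha.symm).trans h'.first_eq
  · exact (exchange_eq_right fun a ha => hN a ha.symm).trans h.last_eq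
  · exact (h'.isLinked k hk).exchange (h.isLinked k hk) (hc k hk).swap

theorem minorOrZero_layerProd_mul_sub_mem [∀ k, Fintype (σ k)] [∀ k, LinearOrder (σ k)]
    [LinearOrder L] {f : ∀ k, σ k → L} {g : ∀ k, σ (k + 1) → L} (hf : ∀ k, Monotone (f k))
    (hg : ∀ k, Monotone (g k)) (w : ∀ k, σ (k + 1) → R) (P : Subsemiring R)
    (hw : ∀ k j, w k j ∈ P) {N : ℕ} {I I' : Finset (σ 0)} {J J' : Finset (σ N)}
    (hI : ∀ a, IsSingle I I' a → 0 ≤ level I I' a)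
    (hJ : ∀ a, IsSingle J' J a → level J' J a < 0) {W : Matrix (σ 0) (σ N) R}
    (hW : W = layerProd (fun k => joinMatrix (f k) (g k) (w k)) N) :
    W.minorOrZero I J * W.minorOrZero I' J' - W.minorOrZero I J' * W.minorOrZero I' J ∈ P := by
  classical
  simp only [hW, minorOrZero_layerProd hf hg, Finset.sum_mul_sum, ← Finset.sum_product']
  set A := families f g N I J ×ˢ families f g N I' J'
  set B := families f g N I J' ×ˢ families f g N I' J
  have himg : B.image (exchangeRight f g N) ⊆ A := by
    intro S hS
    obtain ⟨T, hT, rfl⟩ := Finset.mem_image.1 hS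
    simp only [A, B, Finset.mem_product, mem_families] at hT ⊢
    -- The pair in `B` ends at `J'`, `J` in this order, which is why `hJ` concerns `level J' J`.
    exact hT.1.exchangeRight hf hg hI hJ hT.2
  have hsum : ∑ S ∈ B, familyWeight w N S.1 * familyWeight w N S.2 =
      ∑ S ∈ B.image (exchangeRight f g N), familyWeight w N S.1 * familyWeight w N S.2 := by
    rw [Finset.sum_image fun _ _ _ _ h => (exchangeRight_involutive f g N).injective h]
    exact Finset.sum_congr rfl fun S _ => (familyWeight_exchangeRight f g w N S).symm
  rw [hsum, ← Finset.sum_sdiff himg, add_sub_cancel_right]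
  exact sum_mem fun S _ => mul_mem
    (prod_mem fun k _ => prod_mem fun j _ => hw k j) (prod_mem fun k _ => prod_mem fun j _ => hw k j)

end layers

/-! ### Cutting lines, and recursions for paths. -/

/-- The points `a` and `Z` are listed in increasing order and then continued by unit steps; the step
after `x N` makes room for the stubs at the sinks. -/
theorem exists_strictMono_nat_of_finset (a : ℝ) (Z : Finset ℝ) (hZ : ∀ z ∈ Z, a < z) :
    ∃ (x : ℕ → ℝ) (N : ℕ), StrictMono x ∧ x 0 = a ∧ x (N + 1) = x N + 1 ∧
      (∀ z ∈ Z, ∃ k ≤ N, x k = z) ∧ (x N = a ∨ x N ∈ Z) := by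
  induction Z using Finset.induction_on_max with
  | empty =>
    refine ⟨fun k => a + k, 0, fun k l h => ?_, by simp, by simp, by simp, by simp⟩
    simpa using h
  | insert b Z hb ih =>
    obtain ⟨x, N, hx, h0, -, hmem, hN⟩ := ih fun z hz => hZ z (Finset.mem_insert_of_mem hz)
    have hNb : x N < b := by
      rcases hN with hN | hN
      · rw [hN]
        exact hZ b (Finset.mem_insert_self _ _)
      · exact hb _ hN
    refine ⟨fun k => if k ≤ N then x k else b + ((k : ℝ) - (N + 1)), N + 1, ?_, by simp [h0], ?_,
      ?_, ?_⟩
    · refine strictMono_nat_of_lt_succ fun k => ?_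
      rcases lt_trichotomy k N with hk | rfl | hk
      · rw [if_pos hk.le, if_pos (by omega)]
        exact hx (Nat.lt_succ_self k)
      · simpa using hNb
      · rw [if_neg (by omega), if_neg (by omega)]
        push_cast
        linarith
    · beta_reduce
      rw [if_neg (by omega), if_neg (by omega)]
      push_cast
      ring
    · intro z hz
      rcases Finset.mem_insert.1 hz with rfl | hz
      · exact ⟨N + 1, le_rfl, by simp⟩
      · obtain ⟨k, hk, rfl⟩ := hmem z hz
        exact ⟨k, by omega, if_pos hk⟩
    · right
      simp

namespace PlanarNetwork

variable {n : ℕ} {V E : Type*} [Finite V] [Finite E] (Γ : PlanarNetwork n V E)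

theorem isPath_append_singleton (p : List E) (e : E) (u v : V) :
    Γ.IsPath u v (p ++ [e]) ↔ Γ.IsPath u (Γ.src e) p ∧ Γ.tgt e = v := by
  induction p generalizing u with
  | nil => simp [IsPath, eq_comm]
  | cons d p ih => simp [IsPath, ih, and_assoc]

theorem mem_paths {u v : V} {p : List E} : p ∈ Γ.paths u v ↔ Γ.IsPath u v p := by
  simp [paths]

/-- The generating function of the paths from `u` to `v`. -/
noncomputable def pathSum (u v : V) : MvPolynomial E ℤ :=
  ∑ p ∈ Γ.paths u v, pathWeight p

-- Paths are sorted by their last edge; the empty path gives the first term.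
open Classical in
theorem pathSum_eq [Fintype E] (u v : V) :
    Γ.pathSum u v = (if u = v then 1 else 0) +
      ∑ e, if Γ.tgt e = v then Γ.pathSum u (Γ.src e) * MvPolynomial.X e else 0 := by
  rw [pathSum, ← Finset.sum_filter_add_sum_filter_not _ (fun p => p = [])]
  congr 1
  · split_ifs with h
    · rw [show (Γ.paths u v).filter (fun p => p = []) = {[]} by
        ext p
        simp only [Finset.mem_filter, mem_paths, Finset.mem_singleton, and_iff_right_iff_imp]
        rintro rfl
        exact h]
      simp [pathWeight]
    · refine Finset.sum_eq_zero fun p hp => ?_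
      obtain ⟨hp, rfl⟩ := Finset.mem_filter.1 hp
      exact absurd ((Γ.mem_paths).1 hp) h
  · rw [← Finset.sum_filter]
    simp only [pathSum, Finset.sum_mul]
    rw [Finset.sum_sigma']
    symm
    refine Finset.sum_bij (fun q _ => q.2 ++ [q.1]) ?_ ?_ ?_ ?_
    · rintro ⟨e, p⟩ hq
      simp only [Finset.mem_sigma, Finset.mem_filter, mem_paths] at hq ⊢
      exact ⟨(Γ.isPath_append_singleton p e u v).2 ⟨hq.2, hq.1.2⟩, by simp⟩
    · rintro ⟨e, p⟩ - ⟨e', p'⟩ - h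
      obtain ⟨rfl, h⟩ := List.append_inj' h rfl
      obtain rfl : e = e' := by simpa using h
      rfl
    · intro p hp
      simp only [Finset.mem_filter, mem_paths] at hp
      obtain ⟨hp, hne⟩ := hp
      have hpe := List.dropLast_append_getLast hne
      rw [← hpe, isPath_append_singleton] at hp
      refine ⟨⟨p.getLast hne, p.dropLast⟩, ?_, hpe⟩
      simp only [Finset.mem_sigma, Finset.mem_filter, mem_paths]
      exact ⟨⟨Finset.mem_univ _, hp.2⟩, hp.1⟩
    · rintro ⟨e, p⟩ -
      simp [pathWeight]

/-- A leftmost vertex has no incoming edge, so it is a source. -/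
theorem left_le_pos (v : V) : Γ.left ≤ (Γ.pos v).1 := by
  have : Nonempty V := ⟨v⟩
  obtain ⟨u, hu⟩ := Finite.exists_min fun v => (Γ.pos v).1
  have hs : u ∈ Set.range Γ.source := by
    rw [Γ.mem_range_source]
    rintro e rfl
    exact absurd (hu (Γ.src e)) (Γ.left_to_right e).not_ge
  obtain ⟨i, rfl⟩ := hs
  rw [← Γ.source_left i]
  exact hu v

theorem pos_le_right (v : V) : (Γ.pos v).1 ≤ Γ.right := by
  have : Nonempty V := ⟨v⟩
  obtain ⟨u, hu⟩ := Finite.exists_max fun v => (Γ.pos v).1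
  have hs : u ∈ Set.range Γ.sink := by
    rw [Γ.mem_range_sink]
    rintro e rfl
    exact absurd (hu (Γ.tgt e)) (Γ.left_to_right e).not_ge
  obtain ⟨i, rfl⟩ := hs
  rw [← Γ.sink_right i]
  exact hu v

/-! ### Strands do not cross. -/

/-- The edges, together with horizontal stubs that lead into the sources and out of the sinks. -/
abbrev Strand (n : ℕ) (E : Type*) : Type _ := Fin n ⊕ E ⊕ Fin n

/-- Abscissa of the left end of a strand. -/
def strandLeft : Strand n E → ℝ
  | .inl _ => Γ.left - 1
  | .inr (.inl e) => (Γ.pos (Γ.src e)).1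
  | .inr (.inr _) => Γ.right

/-- Abscissa of the right end of a strand. -/
def strandRight : Strand n E → ℝ
  | .inl _ => Γ.left
  | .inr (.inl e) => (Γ.pos (Γ.tgt e)).1
  | .inr (.inr _) => Γ.right + 1

/-- The function whose graph is the strand. -/
def strandHeight : Strand n E → ℝ → ℝ
  | .inl i => fun _ => (Γ.pos (Γ.source i)).2
  | .inr (.inl e) => Γ.height e
  | .inr (.inr j) => fun _ => (Γ.pos (Γ.sink j)).2

/-- The vertex `v` is the left end of the strand. -/
def StrandStart : Strand n E → V → Prop
  | .inl _ => fun _ => False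
  | .inr (.inl e) => fun v => Γ.src e = v
  | .inr (.inr j) => fun v => Γ.sink j = v

/-- The vertex `v` is the right end of the strand. -/
def StrandEnd : Strand n E → V → Prop
  | .inl i => fun v => Γ.source i = v
  | .inr (.inl e) => fun v => Γ.tgt e = v
  | .inr (.inr _) => fun _ => False

theorem strandLeft_lt_strandRight (s : Strand n E) : Γ.strandLeft s < Γ.strandRight s := by
  rcases s with i | e | j
  · exact sub_one_lt _
  · exact Γ.left_to_right e
  · exact lt_add_one _

theorem continuousOn_strandHeight (s : Strand n E) :
    ContinuousOn (Γ.strandHeight s) (Set.Icc (Γ.strandLeft s) (Γ.strandRight s)) := by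
  rcases s with i | e | j
  · exact continuousOn_const
  · exact Γ.height_continuousOn e
  · exact continuousOn_const

theorem StrandStart.pos_eq {s : Strand n E} {v : V} (h : Γ.StrandStart s v) :
    Γ.pos v = (Γ.strandLeft s, Γ.strandHeight s (Γ.strandLeft s)) := by
  rcases s with i | e | j
  · exact h.elim
  · obtain rfl : Γ.src e = v := h
    exact Prod.ext rfl (Γ.height_src e).symm
  · obtain rfl : Γ.sink j = v := h
    exact Prod.ext (Γ.sink_right j) rfl

theorem StrandEnd.pos_eq {s : Strand n E} {v : V} (h : Γ.StrandEnd s v) :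
    Γ.pos v = (Γ.strandRight s, Γ.strandHeight s (Γ.strandRight s)) := by
  rcases s with i | e | j
  · obtain rfl : Γ.source i = v := h
    exact Prod.ext (Γ.source_left i) rfl
  · obtain rfl : Γ.tgt e = v := h
    exact Prod.ext rfl (Γ.height_tgt e).symm
  · exact h.elim

theorem exists_strandStart {s : Strand n E} (h : Γ.left - 1 < Γ.strandLeft s) :
    ∃ v, Γ.StrandStart s v := by
  rcases s with i | e | j
  · exact absurd h (lt_irrefl _)
  · exact ⟨_, rfl⟩
  · exact ⟨_, rfl⟩

theorem exists_strandEnd {s : Strand n E} (h : Γ.strandRight s ≤ Γ.right) :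
    ∃ v, Γ.StrandEnd s v := by
  rcases s with i | e | j
  · exact ⟨_, rfl⟩
  · exact ⟨_, rfl⟩
  · exact absurd h (lt_add_one _).not_ge

theorem strandHeight_ne_vertex {s : Strand n E} {v : V}
    (h : (Γ.pos v).1 ∈ Set.Ioo (Γ.strandLeft s) (Γ.strandRight s)) :
    Γ.strandHeight s (Γ.pos v).1 ≠ (Γ.pos v).2 := by
  rcases s with i | e | j
  · exact absurd h.2 (Γ.left_le_pos v).not_gt
  · exact Γ.height_ne_vertex e v h
  · exact absurd h.1 (Γ.pos_le_right v).not_gt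

theorem source_height_injective : Function.Injective fun i => (Γ.pos (Γ.source i)).2 := by
  have : StrictAnti fun i => (Γ.pos (Γ.source i)).2 := fun i j h => Γ.source_order i j h
  exact this.injective

theorem sink_height_injective : Function.Injective fun i => (Γ.pos (Γ.sink i)).2 := by
  have : StrictAnti fun i => (Γ.pos (Γ.sink i)).2 := fun i j h => Γ.sink_order i j h
  exact this.injective

theorem strandHeight_ne_strandHeight {s s' : Strand n E} (hne : s ≠ s') {x : ℝ}
    (h : x ∈ Set.Ioo (Γ.strandLeft s) (Γ.strandRight s))
    (h' : x ∈ Set.Ioo (Γ.strandLeft s') (Γ.strandRight s')) :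
    Γ.strandHeight s x ≠ Γ.strandHeight s' x := by
  have hlr := Γ.left_lt_right
  rcases s with i | e | j <;> rcases s' with i' | e' | j'
  · exact fun heq => hne (congrArg _ (Γ.source_height_injective heq))
  · exact absurd (h.2.trans_le (Γ.left_le_pos _)) h'.1.not_gt
  · exact absurd (h.2.trans hlr) h'.1.not_gt
  · exact absurd (h'.2.trans_le (Γ.left_le_pos _)) h.1.not_gt
  · exact Γ.height_ne_height e e' (fun heq => hne (by rw [heq])) x h h'
  · exact absurd (h.2.trans_le (Γ.pos_le_right _)) h'.1.not_gt
  · exact absurd (h'.2.trans hlr) h.1.not_gt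
  · exact absurd (h'.2.trans_le (Γ.pos_le_right _)) h.1.not_gt
  · exact fun heq => hne (by rw [Γ.sink_height_injective heq])

/-- Strands do not cross. -/
theorem strandHeight_le_of_lt {s s' : Strand n E} {p q : ℝ}
    (hp : p ∈ Set.Ioo (Γ.strandLeft s) (Γ.strandRight s))
    (hp' : p ∈ Set.Ioo (Γ.strandLeft s') (Γ.strandRight s'))
    (hq : q ∈ Set.Icc (Γ.strandLeft s) (Γ.strandRight s))
    (hq' : q ∈ Set.Icc (Γ.strandLeft s') (Γ.strandRight s'))
    (h : Γ.strandHeight s p < Γ.strandHeight s' p) :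
    Γ.strandHeight s q ≤ Γ.strandHeight s' q := by
  by_contra! hlt
  have hne : s ≠ s' := by
    rintro rfl
    exact lt_irrefl _ h
  have hc : ContinuousOn (fun x => Γ.strandHeight s x - Γ.strandHeight s' x) (Set.uIcc p q) :=
    ((Γ.continuousOn_strandHeight s).mono
      (Set.uIcc_subset_Icc (Set.Ioo_subset_Icc_self hp) hq)).sub
    ((Γ.continuousOn_strandHeight s').mono
      (Set.uIcc_subset_Icc (Set.Ioo_subset_Icc_self hp') hq'))
  -- A reversal of order would force a meeting point `z ≠ q`, interior to both strands.
  obtain ⟨z, hz, hz0⟩ := intermediate_value_uIcc hc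
    (show (0 : ℝ) ∈ Set.uIcc _ _ from Set.mem_uIcc.2 (Or.inl ⟨by linarith, by linarith⟩))
  have hzq : z ≠ q := by
    rintro rfl
    simp only at hz0
    linarith
  have hmem : ∀ a b : ℝ, p ∈ Set.Ioo a b → q ∈ Set.Icc a b → z ∈ Set.Ioo a b := by
    intro a b h1 h2
    rcases Set.mem_uIcc.1 hz with h3 | h3
    · exact ⟨h1.1.trans_le h3.1, (lt_of_le_of_ne h3.2 hzq).trans_le h2.2⟩
    · exact ⟨h2.1.trans_lt (lt_of_le_of_ne h3.1 hzq.symm), h3.2.trans_lt h1.2⟩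
  exact Γ.strandHeight_ne_strandHeight hne (hmem _ _ hp hq) (hmem _ _ hp' hq') (sub_eq_zero.1 hz0)

/-! ### Layers, and path counting by last strand. -/

/-- The strands that join the vertical lines with abscissas `x k` and `x (k + 1)`. -/
@[ext]
structure Layer (x : ℕ ↪o ℝ) (k : ℕ) where
  /-- the strand -/
  strand : Strand n E
  left_le : Γ.strandLeft strand ≤ x k
  le_right : x (k + 1) ≤ Γ.strandRight strand

namespace Layer

variable {Γ} {x : ℕ ↪o ℝ} {k : ℕ}

noncomputable instance : Fintype (Γ.Layer x k) :=
  have : Finite (Γ.Layer x k) := Finite.of_injective Layer.strand fun _ _ h => Layer.ext h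
  Fintype.ofFinite _

theorem lt_succ (x : ℕ ↪o ℝ) (k : ℕ) : x k < x (k + 1) :=
  x.strictMono (Nat.lt_succ_self k)

/-- The order of the strands from top to bottom. -/
noncomputable def midHeight (s : Γ.Layer x k) : ℝ :=
  -Γ.strandHeight s.strand ((x k + x (k + 1)) / 2)

theorem mid_mem (s : Γ.Layer x k) :
    (x k + x (k + 1)) / 2 ∈ Set.Ioo (Γ.strandLeft s.strand) (Γ.strandRight s.strand) := by
  have h1 := s.left_le
  have h2 := s.le_right
  have h3 := lt_succ x k
  constructor <;> linarith

theorem midHeight_injective : Function.Injective (midHeight : Γ.Layer x k → ℝ) := by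
  intro s s' h
  by_contra hne
  exact Γ.strandHeight_ne_strandHeight (fun h => hne (Layer.ext h)) s.mid_mem s'.mid_mem
    (neg_injective h)

/-- Heights are negated so that the order agrees with the numbering of sources and sinks from top to
bottom. -/
noncomputable instance : LinearOrder (Γ.Layer x k) :=
  LinearOrder.lift' midHeight midHeight_injective

theorem lt_iff {s s' : Γ.Layer x k} : s < s' ↔ s.midHeight < s'.midHeight :=
  Iff.rfl

theorem height_le {s s' : Γ.Layer x k} (h : s ≤ s') {q : ℝ} (hq : q ∈ Set.Icc (x k) (x (k + 1))) :
    -Γ.strandHeight s.strand q ≤ -Γ.strandHeight s'.strand q := by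
  rcases h.lt_or_eq with h | rfl
  · exact neg_le_neg (Γ.strandHeight_le_of_lt s'.mid_mem s.mid_mem
      ⟨s'.left_le.trans hq.1, hq.2.trans s'.le_right⟩ ⟨s.left_le.trans hq.1, hq.2.trans s.le_right⟩
      (neg_lt_neg_iff.1 (lt_iff.1 h)))
  · exact le_rfl

/-- Position at which a strand meets the column on its right. -/
noncomputable def rightPoint (s : Γ.Layer x k) : ℝ :=
  -Γ.strandHeight s.strand (x (k + 1))

/-- Position at which a strand meets the column on its left. -/
noncomputable def leftPoint (s : Γ.Layer x (k + 1)) : ℝ :=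
  -Γ.strandHeight s.strand (x (k + 1))

theorem rightPoint_monotone : Monotone (rightPoint : Γ.Layer x k → ℝ) :=
  fun _ _ h => height_le h ⟨(lt_succ x k).le, le_rfl⟩

theorem leftPoint_monotone : Monotone (leftPoint : Γ.Layer x (k + 1) → ℝ) :=
  fun _ _ h => height_le h ⟨le_rfl, (lt_succ x (k + 1)).le⟩

end Layer

/-- The weight of a strand. -/
noncomputable def strandWeight : Strand n E → MvPolynomial E ℤ
  | .inr (.inl e) => MvPolynomial.X e
  | _ => 1

open Classical in
/-- The weight that a strand contributes at the column on its left. -/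
noncomputable def Layer.weight {Γ : PlanarNetwork n V E} {x : ℕ ↪o ℝ} {k : ℕ}
    (s : Γ.Layer x (k + 1)) : MvPolynomial E ℤ :=
  if Γ.strandLeft s.strand = x (k + 1) then strandWeight s.strand else 1

open Classical in
/-- The generating function of the paths that start at a given source and end with a given
strand. -/
noncomputable def strandSum (i : Fin n) : Strand n E → MvPolynomial E ℤ
  | .inl i' => if i = i' then 1 else 0
  | .inr (.inl e) => Γ.pathSum (Γ.source i) (Γ.src e) * MvPolynomial.X e
  | .inr (.inr j) => Γ.pathSum (Γ.source i) (Γ.sink j)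

variable {Γ}

theorem StrandStart.strandSum_eq {s : Strand n E} {v : V} (h : Γ.StrandStart s v) (i : Fin n) :
    Γ.strandSum i s = Γ.pathSum (Γ.source i) v * strandWeight s := by
  rcases s with i' | e | j
  · exact h.elim
  · obtain rfl : Γ.src e = v := h
    rfl
  · obtain rfl : Γ.sink j = v := h
    exact (mul_one _).symm

variable (Γ)

open Classical in
theorem sum_strandSum [Fintype E] (i : Fin n) (v : V) :
    (∑ s : Strand n E, if Γ.StrandEnd s v then Γ.strandSum i s else 0) =
      Γ.pathSum (Γ.source i) v := by
  rw [pathSum_eq, Fintype.sum_sum_type, Fintype.sum_sum_type]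
  have h1 : (∑ i', if Γ.StrandEnd (E := E) (.inl i') v then Γ.strandSum i (.inl i') else 0) =
      if Γ.source i = v then 1 else 0 := by
    rw [Finset.sum_eq_single i]
    · exact if_congr Iff.rfl (if_pos rfl) rfl
    · intro i' _ hi'
      simp [strandSum, hi'.symm]
    · simp
  have h3 : (∑ j, if Γ.StrandEnd (E := E) (.inr (.inr j)) v then Γ.strandSum i (.inr (.inr j))
      else 0) = 0 := Finset.sum_eq_zero fun j _ => if_neg id
  rw [h1, h3, add_zero]
  rfl

variable {x : ℕ ↪o ℝ} {N : ℕ}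

theorem strandLeft_le_of_lt {s : Strand n E} {k : ℕ} (hl : ∃ m, x m = Γ.strandLeft s)
    (h : Γ.strandLeft s < x (k + 1)) : Γ.strandLeft s ≤ x k := by
  obtain ⟨m, hm⟩ := hl
  rw [← hm] at h ⊢
  exact x.le_iff_le.2 (Nat.lt_succ_iff.1 (x.lt_iff_lt.1 h))

/-- A strand meeting the column at `v` must end there, as no strand passes through a vertex.
Conversely, a strand ending at `v` spans the whole layer, because its left end is on a column. -/
theorem pathSum_eq_sum_layer {k : ℕ} (hl : ∀ s : Strand n E, ∃ m, x m = Γ.strandLeft s)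
    (hk : x (k + 1) ≤ Γ.right) (i : Fin n) {v : V} (hv : (Γ.pos v).1 = x (k + 1)) :
    ∑ e : Γ.Layer x k, (open Classical in
      if Γ.strandHeight e.strand (x (k + 1)) = (Γ.pos v).2 then Γ.strandSum i e.strand else 0) =
      Γ.pathSum (Γ.source i) v := by
  classical
  have := Fintype.ofFinite E
  rw [← sum_strandSum, ← Finset.sum_filter, ← Finset.sum_filter]
  refine Finset.sum_bij (fun e _ => e.strand) (fun e he => ?_) (fun _ _ _ _ h => Layer.ext h)
    (fun s hs => ?_) (fun _ _ => rfl)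
  · have he' := (Finset.mem_filter.1 he).2
    rw [Finset.mem_filter, and_iff_right (Finset.mem_univ _)]
    have hr : Γ.strandRight e.strand = x (k + 1) := by
      refine le_antisymm ?_ e.le_right
      by_contra! hlt
      refine Γ.strandHeight_ne_vertex (s := e.strand) (v := v) ?_ (by rw [hv, he'])
      rw [hv]
      exact ⟨e.left_le.trans_lt (Layer.lt_succ x k), hlt⟩
    obtain ⟨u, hu⟩ := Γ.exists_strandEnd (hr.trans_le hk)
    have huv : u = v := Γ.pos_injective <| by
      rw [hu.pos_eq, hr, he', ← hv]
    exact huv ▸ hu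
  · have hs' := (Finset.mem_filter.1 hs).2
    have hp := hs'.pos_eq
    have hr : Γ.strandRight s = x (k + 1) := by
      rw [← hv, hp]
    refine ⟨⟨s, Γ.strandLeft_le_of_lt (hl s) (hr ▸ Γ.strandLeft_lt_strandRight s), hr.ge⟩, ?_, rfl⟩
    rw [Finset.mem_filter, and_iff_right (Finset.mem_univ _)]
    simp only [hp, hr]

/-- A strand running through the column meets only itself there. A strand starting there, at `v`,
collects all paths to `v` and is charged its weight at this column only. -/
theorem sum_layer_eq {k : ℕ} (hl : ∀ s : Strand n E, ∃ m, x m = Γ.strandLeft s)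
    (h0 : x 0 = Γ.left - 1) (hk : x (k + 1) ≤ Γ.right) (i : Fin n) (s : Γ.Layer x (k + 1)) :
    ∑ e : Γ.Layer x k, Γ.strandSum i e.strand *
      joinMatrix Layer.rightPoint Layer.leftPoint Layer.weight e s = Γ.strandSum i s.strand := by
  classical
  have hx1 := Layer.lt_succ x (k + 1)
  have hx0 := Layer.lt_succ x k
  simp only [joinMatrix, Matrix.of_apply, Layer.rightPoint, Layer.leftPoint, neg_inj]
  rcases s.left_le.lt_or_eq with hlt | heq
  · have hs : Γ.strandLeft s.strand ≤ x k := Γ.strandLeft_le_of_lt (hl s.strand) hlt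
    have hmem : x (k + 1) ∈ Set.Ioo (Γ.strandLeft s.strand) (Γ.strandRight s.strand) :=
      ⟨hlt, hx1.trans_le s.le_right⟩
    rw [Finset.sum_eq_single (⟨s.strand, hs, hx1.le.trans s.le_right⟩ : Γ.Layer x k)]
    · rw [if_pos rfl, Layer.weight, if_neg hlt.ne, mul_one]
    · intro e _ hne
      rw [if_neg, mul_zero]
      intro hee
      rcases e.le_right.lt_or_eq with hlt' | heq'
      · exact Γ.strandHeight_ne_strandHeight (fun h => hne (Layer.ext h))
          ⟨e.left_le.trans_lt hx0, hlt'⟩ hmem hee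
      · obtain ⟨u, hu⟩ := Γ.exists_strandEnd (heq'.symm.trans_le hk)
        have hp := hu.pos_eq
        rw [← heq'] at hp
        refine Γ.strandHeight_ne_vertex (s := s.strand) (v := u) ?_ ?_
        · rwa [hp]
        · rw [hp, hee]
    · exact fun h => absurd (Finset.mem_univ _) h
  · obtain ⟨v, hv⟩ := Γ.exists_strandStart (s := s.strand) (by
      rw [heq, ← h0]
      exact x.strictMono (Nat.succ_pos k))
    have hp := hv.pos_eq
    rw [heq] at hp
    rw [hv.strandSum_eq, ← Γ.pathSum_eq_sum_layer hl hk i (v := v) (by rw [hp]), Finset.sum_mul]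
    refine Finset.sum_congr rfl fun e _ => ?_
    rw [Layer.weight, if_pos heq, hp]
    split_ifs <;> simp

end PlanarNetwork

/-! ### Nonnegative polynomials, and the factorization of the weight matrix. -/

theorem isSingle_map {σ τ : Type*} (e : σ ↪ τ) {K K' : Finset σ} {a : σ} :
    IsSingle (K.map e) (K'.map e) (e a) ↔ IsSingle K K' a := by
  simp [IsSingle]

theorem level_map {σ τ : Type*} [LinearOrder σ] [LinearOrder τ] (e : σ ≃o τ) (K K' : Finset σ)
    (a : σ) :
    level (K.map e.toEquiv.toEmbedding) (K'.map e.toEquiv.toEmbedding) (e a) = level K K' a := by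
  simp [level, Finset.filter_map]

namespace MvPolynomial

/-- The polynomials with nonnegative coefficients. -/
def nonnegCoeff (E : Type*) : Subsemiring (MvPolynomial E ℤ) where
  carrier := {p | ∀ d, 0 ≤ p.coeff d}
  mul_mem' := fun {p q} hp hq d => by
    classical
    rw [coeff_mul]
    exact Finset.sum_nonneg fun x _ => mul_nonneg (hp _) (hq _)
  one_mem' := fun d => by
    classical
    rw [coeff_one]
    split_ifs <;> simp
  add_mem' := fun {p q} hp hq d => by
    rw [coeff_add]
    exact add_nonneg (hp d) (hq d)
  zero_mem' := fun d => by rw [coeff_zero]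

theorem X_mem_nonnegCoeff {E : Type*} (e : E) : (X e : MvPolynomial E ℤ) ∈ nonnegCoeff E := by
  classical
  intro d
  rw [coeff_X]
  split_ifs <;> simp

end MvPolynomial

namespace PlanarNetwork

variable {n : ℕ} {V E : Type*} [Finite V] [Finite E] (Γ : PlanarNetwork n V E)

theorem Layer.weight_mem {Γ : PlanarNetwork n V E} {x : ℕ ↪o ℝ} {k : ℕ}
    (s : Γ.Layer x (k + 1)) : s.weight ∈ MvPolynomial.nonnegCoeff E := by
  rw [weight]
  split_ifs
  · rcases s.strand with i | e | j
    · exact one_mem _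
    · exact MvPolynomial.X_mem_nonnegCoeff e
    · exact one_mem _
  · exact one_mem _

/-- It is enough that left ends lie on columns; right ends need no separate treatment. -/
theorem exists_columns : ∃ (x : ℕ ↪o ℝ) (N : ℕ), x 0 = Γ.left - 1 ∧ x N = Γ.right ∧
    x (N + 1) = Γ.right + 1 ∧ ∀ s : Strand n E, ∃ m, x m = Γ.strandLeft s := by
  classical
  have := Fintype.ofFinite E
  have hlr := Γ.left_lt_right
  have hle : ∀ s : Strand n E, Γ.left - 1 ≤ Γ.strandLeft s ∧ Γ.strandLeft s ≤ Γ.right := by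
    rintro (i | e | j)
    · exact ⟨le_rfl, by linarith [show Γ.strandLeft (E := E) (.inl i) = Γ.left - 1 from rfl]⟩
    · exact ⟨by linarith [show Γ.strandLeft (.inr (.inl e)) = (Γ.pos (Γ.src e)).1 from rfl,
        Γ.left_le_pos (Γ.src e)], Γ.pos_le_right _⟩
    · exact ⟨by linarith [show Γ.strandLeft (E := E) (.inr (.inr j)) = Γ.right from rfl], le_rfl⟩
  set Z : Finset ℝ := insert Γ.right
    ((Finset.univ.image (Γ.strandLeft)).filter (Γ.left - 1 < ·)) with hZ
  have hZr : ∀ z ∈ Z, z ≤ Γ.right := by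
    intro z hz
    rcases Finset.mem_insert.1 hz with rfl | hz
    · exact le_rfl
    · obtain ⟨s, -, rfl⟩ := Finset.mem_image.1 (Finset.mem_filter.1 hz).1
      exact (hle s).2
  obtain ⟨x, N, hx, h0, h1, hmem, hN⟩ := exists_strictMono_nat_of_finset (Γ.left - 1) Z (by
    intro z hz
    rcases Finset.mem_insert.1 hz with rfl | hz
    · linarith
    · exact (Finset.mem_filter.1 hz).2)
  have hxN : x N = Γ.right := by
    refine le_antisymm ?_ ?_
    · rcases hN with hN | hN
      · linarith
      · exact hZr _ hN
    · obtain ⟨k, hk, hkr⟩ := hmem Γ.right (Finset.mem_insert_self _ _)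
      exact hkr ▸ hx.monotone hk
  refine ⟨OrderEmbedding.ofStrictMono x hx, N, h0, hxN, h1.trans (by rw [hxN]), fun s => ?_⟩
  rcases (hle s).1.lt_or_eq with h | h
  · obtain ⟨k, -, hk⟩ := hmem (Γ.strandLeft s) (Finset.mem_insert_of_mem
      (Finset.mem_filter.2 ⟨Finset.mem_image_of_mem _ (Finset.mem_univ _), h⟩))
    exact ⟨k, hk⟩
  · exact ⟨0, h0.trans h⟩

variable {x : ℕ ↪o ℝ} {N : ℕ}

theorem exists_orderIso_layer_zero (h0 : x 0 = Γ.left - 1)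
    (hl : ∀ s : Strand n E, ∃ m, x m = Γ.strandLeft s) :
    ∃ e : Fin n ≃o Γ.Layer x 0, ∀ i, (e i).strand = .inl i := by
  have hlr := Γ.left_lt_right
  -- A source is not a sink, since `left < right`, so an edge starts there and makes `left` a
  -- column; hence the first layer stops at or before `left`.
  have h1 : n ≠ 0 → x 1 ≤ Γ.left := by
    intro hn
    have hi : ∃ e, Γ.src e = Γ.source ⟨0, Nat.pos_of_ne_zero hn⟩ := by
      by_contra! hcon
      obtain ⟨j, hj⟩ := (Γ.mem_range_sink _).2 hcon
      have := Γ.sink_right j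
      rw [hj, Γ.source_left] at this
      exact hlr.ne this
    obtain ⟨e, he⟩ := hi
    obtain ⟨m, hm⟩ := hl (.inr (.inl e))
    have hm' : x m = Γ.left := by
      rw [hm, ← Γ.source_left ⟨0, Nat.pos_of_ne_zero hn⟩, ← he]
      rfl
    rw [← hm']
    refine x.monotone (Nat.one_le_iff_ne_zero.2 ?_)
    rintro rfl
    linarith
  set c : Fin n → Γ.Layer x 0 := fun i => ⟨.inl i, h0.ge, h1 (by
    rintro rfl
    exact i.elim0)⟩ with hc
  refine ⟨StrictMono.orderIsoOfSurjective c ?_ ?_, fun i => rfl⟩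
  · intro i j hij
    exact neg_lt_neg (Γ.source_order i j hij)
  · rintro ⟨s, hs, hs'⟩
    rw [h0] at hs
    rcases s with i | e | j
    · exact ⟨i, rfl⟩
    · have := Γ.left_le_pos (Γ.src e)
      have hs : (Γ.pos (Γ.src e)).1 ≤ Γ.left - 1 := hs
      linarith
    · have hs : Γ.right ≤ Γ.left - 1 := hs
      linarith

theorem exists_orderIso_layer_last (hN : x N = Γ.right) (hN' : x (N + 1) = Γ.right + 1) :
    ∃ e : Fin n ≃o Γ.Layer x N, ∀ i, (e i).strand = .inr (.inr i) := by
  have hlr := Γ.left_lt_right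
  set c : Fin n → Γ.Layer x N := fun i => ⟨.inr (.inr i), hN.ge, hN'.le⟩ with hc
  refine ⟨StrictMono.orderIsoOfSurjective c ?_ ?_, fun i => rfl⟩
  · intro i j hij
    exact neg_lt_neg (Γ.sink_order i j hij)
  · rintro ⟨s, hs, hs'⟩
    rw [hN'] at hs'
    rcases s with i | e | j
    · have hs' : Γ.right + 1 ≤ Γ.left := hs'
      linarith
    · have := Γ.pos_le_right (Γ.tgt e)
      have hs' : Γ.right + 1 ≤ (Γ.pos (Γ.tgt e)).1 := hs'
      linarith
    · exact ⟨j, rfl⟩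

/-- The product of the matrices of the first columns counts paths by their last strands. -/
theorem layerProd_joinMatrix_apply (hl : ∀ s : Strand n E, ∃ m, x m = Γ.strandLeft s)
    (h0 : x 0 = Γ.left - 1) (hN : x N = Γ.right) (e : Fin n ≃o Γ.Layer x 0)
    (he : ∀ i, (e i).strand = .inl i) (i : Fin n) (k : ℕ) (hk : k ≤ N) (s : Γ.Layer x k) :
    layerProd (fun k => joinMatrix (Layer.rightPoint (Γ := Γ) (x := x) (k := k)) Layer.leftPoint
      Layer.weight) k (e i) s = Γ.strandSum i s.strand := by
  classical
  induction k with
  | zero =>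
    obtain ⟨j, rfl⟩ := e.surjective s
    rw [layerProd, he, Matrix.one_apply, strandSum]
    simp
  | succ k ih =>
    rw [layerProd, Matrix.mul_apply, ← Γ.sum_layer_eq hl h0 (hN ▸ x.monotone hk) i s]
    exact Finset.sum_congr rfl fun t _ => by rw [ih (by omega) t]

theorem minorOrZero_weightMatrix_mul_sub_mem {I I' J J' : Finset (Fin n)}
    (hI : ∀ a, IsSingle I I' a → 0 ≤ level I I' a)
    (hJ : ∀ a, IsSingle J' J a → level J' J a < 0) :
    Γ.weightMatrix.minorOrZero I J * Γ.weightMatrix.minorOrZero I' J' -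
      Γ.weightMatrix.minorOrZero I J' * Γ.weightMatrix.minorOrZero I' J ∈
        MvPolynomial.nonnegCoeff E := by
  obtain ⟨x, N, h0, hN, hN', hl⟩ := Γ.exists_columns
  obtain ⟨e, he⟩ := Γ.exists_orderIso_layer_zero h0 hl
  obtain ⟨e', he'⟩ := Γ.exists_orderIso_layer_last hN hN'
  have hW : Γ.weightMatrix = (layerProd (fun k => joinMatrix
      (Layer.rightPoint (Γ := Γ) (x := x) (k := k)) Layer.leftPoint Layer.weight) N).submatrix
      e e' := by
    ext1 i j
    rw [Matrix.submatrix_apply, Γ.layerProd_joinMatrix_apply hl h0 hN e he i N le_rfl, he']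
    rfl
  have key := minorOrZero_layerProd_mul_sub_mem (σ := fun k => Γ.Layer x k) (N := N)
    (f := fun _ => Layer.rightPoint) (g := fun _ => Layer.leftPoint)
    (I := I.map e.toEquiv.toEmbedding) (I' := I'.map e.toEquiv.toEmbedding)
    (J := J.map e'.toEquiv.toEmbedding) (J' := J'.map e'.toEquiv.toEmbedding)
    (fun _ => Layer.rightPoint_monotone) (fun _ => Layer.leftPoint_monotone)
    (fun _ => Layer.weight) (MvPolynomial.nonnegCoeff E) (fun _ s => s.weight_mem)
    (fun a ha => ?_) (fun a ha => ?_) rfl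
  · rw [hW]
    simp only [Matrix.minorOrZero_submatrix_orderIso]
    exact key
  · obtain ⟨b, rfl⟩ := e.surjective a
    rw [level_map]
    exact hI b ((isSingle_map e.toEquiv.toEmbedding).1 ha)
  · obtain ⟨b, rfl⟩ := e'.surjective a
    rw [level_map]
    exact hJ b ((isSingle_map e'.toEquiv.toEmbedding).1 ha)

end PlanarNetwork

/-! ### Levels of shifted index sets. -/

namespace ShiftIndex

variable {m : ℕ} {A : Finset ℕ} {i i' : ShiftIndex m A}

/-- Subtracting `i' - i` maps `i' + A` into `i + A` and makes every element strictly smaller. -/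
theorem card_filter_le_le_card_filter_lt (h : i < i') (a : Fin m) :
    (i'.shift.filter (· ≤ a)).card ≤ (i.shift.filter (· < a)).card := by
  have hlt : (i.1 : ℕ) < i'.1 := h
  refine Finset.card_le_card_of_injOn
    (fun b => ⟨(b : ℕ) - (i'.1 - i.1), (Nat.sub_le _ _).trans_lt b.2⟩) ?_ ?_
  · intro b hb
    obtain ⟨hb, hba⟩ := Finset.mem_filter.1 (Finset.mem_coe.1 hb)
    obtain ⟨c, hc, hcb⟩ := (i'.mem_shift b).1 hb
    have hba : (b : ℕ) ≤ a := hba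
    rw [Finset.mem_coe, Finset.mem_filter, mem_shift, Fin.lt_def]
    exact ⟨⟨c, hc, by dsimp only; omega⟩, by dsimp only; omega⟩
  · intro b hb b' hb' hbb
    obtain ⟨c, hc, hcb⟩ := (i'.mem_shift b).1 (Finset.mem_filter.1 (Finset.mem_coe.1 hb)).1
    obtain ⟨c', hc', hcb'⟩ := (i'.mem_shift b').1 (Finset.mem_filter.1 (Finset.mem_coe.1 hb')).1
    have := Fin.mk.inj hbb
    exact Fin.ext (by omega)

theorem level_shift_nonneg (h : i < i') (a : Fin m) : 0 ≤ level i.shift i'.shift a := by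
  have := card_filter_le_le_card_filter_lt h a
  rw [level]
  omega

/-- Strictness comes from `a` itself: it lies in one of the sets, where `≤ a` counts it and `< a`
does not. -/
theorem level_shift_neg (h : i < i') {a : Fin m} (ha : IsSingle i'.shift i.shift a) :
    level i'.shift i.shift a < 0 := by
  have h1 := card_filter_le_le_card_filter_lt h a
  have h2 : ∀ K : Finset (Fin m), (K.filter (· < a)).card ≤ (K.filter (· ≤ a)).card := fun K =>
    Finset.card_le_card (Finset.monotone_filter_right K fun _ _ hb => hb.le)
  have h3 : ∀ K : Finset (Fin m), a ∈ K → (K.filter (· < a)).card < (K.filter (· ≤ a)).card :=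
    fun K haK => Finset.card_lt_card <| by
      refine ⟨Finset.monotone_filter_right K fun _ _ hb => hb.le, fun hsub => ?_⟩
      have := hsub (Finset.mem_filter.2 ⟨haK, le_rfl⟩)
      exact lt_irrefl _ (Finset.mem_filter.1 this).2
  rw [level]
  rcases ha with ha | ha
  · have := h3 _ ha.1
    have := h2 i.shift
    omega
  · have := h3 _ ha.1
    have := h2 i'.shift
    omega

end ShiftIndex

theorem theorem1p1 {n : ℕ} {V E : Type*} [Finite V] [Finite E] (Γ : PlanarNetwork n V E)
    {k : ℕ} (A B : Finset ℕ) (hA : A.card = k) (hB : B.card = k)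
    (hAn : A ⊆ Finset.range n) (hBn : B ⊆ Finset.range n)
    (C : Finset (ShiftIndex n A)) (D : Finset (ShiftIndex n B))
    (hC : C.card = 2) (hD : D.card = 2) (d : E →₀ ℕ) :
    0 ≤ ((Γ.weightMatrix.minorMatrix A B hA hB).setMinor C D hC hD).coeff d := by
  have hc : C.orderEmbOfFin hC 0 < C.orderEmbOfFin hC 1 :=
    (C.orderEmbOfFin hC).strictMono Fin.zero_lt_one
  have hd : D.orderEmbOfFin hD 0 < D.orderEmbOfFin hD 1 :=
    (D.orderEmbOfFin hD).strictMono Fin.zero_lt_one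
  rw [Matrix.setMinor, Matrix.det_fin_two]
  simp only [Matrix.submatrix_apply, Matrix.minorMatrix, Matrix.of_apply,
    Matrix.setMinor_eq_minorOrZero]
  exact Γ.minorOrZero_weightMatrix_mul_sub_mem
    (fun a _ => ShiftIndex.level_shift_nonneg hc a) (fun a ha => ShiftIndex.level_shift_neg hd ha) d
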